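/- Let $U:\mathbb Z\to\mathbb R$ satisfy $\mathcal Z=\sum_{x\in\mathbb Z}e^{-U(x)}<\infty$, and put $\pi(x)=e^{-U(x)}/\mathcal Z$ and $\mu(x,v)=\pi(x)/2$ for $(x,v)\in\mathbb Z\times\{-1,1\}$. The Zig-Zag walk is the Markov chain $(X_k,V_k)_{k\ge 0}$ on $\mathbb Z\times\{-1,1\}$ which from $(x,v)$ moves to $(x+v,v)$ with probability $\min\left(\frac{\pi(x+v)}{\pi(x)},1\right)$ and to $(x,-v)$ otherwise. Suppose that $U$ is non-increasing on $\{x\in\mathbb Z: x\le 0\}$ and non-decreasing on $\{x\in\mathbb Z: x\ge 0\}$, and let $f\in L^1(\mu)$. Then, for every initial condition, almost surely, $$\frac1n\sum_{k=0}^{n-1}f(X_k,V_k)\ \underset{n\to\infty}{\longrightarrow}\ \mu(f)=\sum_{x\in\mathbb Z,\,v=\pm1} f(x,v)\,\mu(x,v).$$ Moreover, let $g(x)=f(x,1)+f(x,-1)$ and $$F(x)=\tfrac12 g(x)+\mathbf 1_{x\ge 1}\sum_{i=1}^{x-1}g(i)+\mathbf 1_{x\le -1}\sum_{i=x+1}^{-1}g(i).$$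 Suppose that $gF$ is $\pi$-integrable, put $M_f=\sum_{x\in\mathbb Z}g(x)F(x)\pi(x)$, and suppose that $\mu(f)=0$. Then, for every initial condition, $$\frac1{\sqrt n}\sum_{k=0}^{n-1}f(X_k,V_k)\ \overset{law}{\underset{n\to\infty}{\longrightarrow}}\ \mathcal N(0,\sigma_f^2),$$ where the variance $$\sigma_f^2=M_f-\frac{\pi(0)g(0)^2}{2}-\frac1{2\pi(0)}\left[\Big(\sum_{x\ge 1}g(x)\pi(x)\Big)^2+\Big(\sum_{x\le -1}g(x)\pi(x)\Big)^2\right]$$ satisfies $0\le\sigma_f^2\le 3M_f$. (For $\sigma_f^2=0$, $\mathcal N(0,0)$ is the Dirac mass at $0$.) -/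

import Mathlib

open MeasureTheory ProbabilityTheory Filter Topology

namespace ZigZag

/-- Phase space `ℤ × {-1, 1}` of (position, velocity); `ℤˣ = {1, -1}`. -/
abbrev State : Type := ℤ × ℤˣ

instance : MeasurableSingletonClass ℤˣ where
  measurableSet_singleton v := by
    refine ⟨{(v : ℤ)}, measurableSet_singleton _, ?_⟩
    ext w
    simp [Units.ext_iff]

/-- The partition function `∑ exp (-U x)`. -/
noncomputable def partition (U : ℤ → ℝ) : ℝ := ∑' x : ℤ, Real.exp (-U x)

/-- The Gibbs weight `π(x) = exp (-U x) / 𝒵`. -/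
noncomputable def gibbs (U : ℤ → ℝ) (x : ℤ) : ℝ := Real.exp (-U x) / partition U

/-- The Gibbs distribution `π`, as a measure on `ℤ`. -/
noncomputable def gibbsMeasure (U : ℤ → ℝ) : Measure ℤ :=
  Measure.count.withDensity fun x => ENNReal.ofReal (gibbs U x)

/-- The measure `μ(x, v) = π(x) / 2` on the phase space. -/
noncomputable def phaseMeasure (U : ℤ → ℝ) : Measure State :=
  Measure.count.withDensity fun z => ENNReal.ofReal (gibbs U z.1 / 2)

/-- The probability `min (π(x + v) / π(x)) 1` of moving from `(x, v)` to `(x + v, v)`. -/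
noncomputable def moveProb (U : ℤ → ℝ) (z : State) : ℝ :=
  min (gibbs U (z.1 + (z.2 : ℤ)) / gibbs U z.1) 1

/-- The transition kernel of the Zig-Zag walk on `ℤ`: from `(x, v)` go to `(x + v, v)` with
probability `moveProb U (x, v)`, and to `(x, -v)` otherwise. -/
noncomputable def kernel (U : ℤ → ℝ) : Kernel State State :=
  Kernel.ofFunOfCountable fun z =>
    ENNReal.ofReal (moveProb U z) • Measure.dirac (z.1 + (z.2 : ℤ), z.2) +
      ENNReal.ofReal (1 - moveProb U z) • Measure.dirac (z.1, -z.2)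

instance (U : ℤ → ℝ) : IsMarkovKernel (kernel U) where
  isProbabilityMeasure z := by
    have hpos : ∀ x, 0 ≤ gibbs U x := fun x =>
      div_nonneg (Real.exp_pos _).le (tsum_nonneg fun _ => (Real.exp_pos _).le)
    have h0 : 0 ≤ moveProb U z := le_min (div_nonneg (hpos _) (hpos _)) zero_le_one
    have h1 : moveProb U z ≤ 1 := min_le_right _ _
    constructor
    simp [kernel, Kernel.ofFunOfCountable, ← ENNReal.ofReal_add h0 (sub_nonneg.2 h1)]

/-- `X` is, under `P`, a (time-homogeneous) Markov chain on the countable discrete space `S` with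
transition kernel `κ` and an arbitrary initial law. -/
structure IsMarkovChain {Ω S : Type*} [MeasurableSpace Ω] [MeasurableSpace S]
    (P : Measure Ω) (κ : Kernel S S) (X : ℕ → Ω → S) : Prop where
  measurable : ∀ n, Measurable (X n)
  transition : ∀ (n : ℕ) (s : ℕ → S),
    P {ω | ∀ k ≤ n + 1, X k ω = s k} = P {ω | ∀ k ≤ n, X k ω = s k} * κ (s n) {s (n + 1)}

/-- `g(x) = f(x, 1) + f(x, -1)`. -/
def g (f : State → ℝ) (x : ℤ) : ℝ := f (x, 1) + f (x, -1)

/-- `F(x) = g(x)/2 + 1_{x ≥ 1} ∑_{i=1}^{x-1} g(i) + 1_{x ≤ -1} ∑_{i=x+1}^{-1} g(i)`. -/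
noncomputable def F (f : State → ℝ) (x : ℤ) : ℝ :=
  1 / 2 * g f x + (if 1 ≤ x then ∑ i ∈ Finset.Icc 1 (x - 1), g f i else 0) +
    (if x ≤ -1 then ∑ i ∈ Finset.Icc (x + 1) (-1), g f i else 0)

/-- `M_f = E_π (g(X) F(X))`. -/
noncomputable def M (U : ℤ → ℝ) (f : State → ℝ) : ℝ := ∫ x, g f x * F f x ∂(gibbsMeasure U)

/-- The asymptotic variance `σ_f²`, in closed form. -/
noncomputable def asympVar (U : ℤ → ℝ) (f : State → ℝ) : ℝ :=
  M U f - gibbs U 0 * g f 0 ^ 2 / 2 -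
    ((∫ x in Set.Ici (1 : ℤ), g f x ∂(gibbsMeasure U)) ^ 2 +
      (∫ x in Set.Iic (-1 : ℤ), g f x ∂(gibbsMeasure U)) ^ 2) / (2 * gibbs U 0)

end ZigZag

/-! The proof is a regeneration argument at the state `(0, 1)`. Since the Gibbs weight decreases
away from the origin, a walk moving outwards on the half-line `k * v` advances with probability
`π((k+1)v) / π(kv)`, whereas a walk moving inwards never turns. An excursion from `(0, v)` is
therefore described by one integer, the number of outward steps before turning. Telescoping shows
that it exceeds `k` with probability `π((k+1)v) / π(0)` (`measureReal_excursionMeasure_Ioi`), and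
the excursion almost surely ends at `(0, -v)`.

A cycle is an excursion to the right followed by an independent one to the left. It meets every site
of its range exactly once with each velocity, so its sum of `f` is `g(0)` plus the sums of `g` over
both excursions (`sum_cycle`). Its mean is `2 μ(f) / π(0)`, and its mean length is `2 / π(0)`
(`integrable_and_integral_cycleSum`, `integrable_and_integral_length`). By the Markov property the
successive cycles are independent with a common law, after an independent delay (`renewal`).

The law of large numbers is then the renewal-reward theorem (`Renewal.ae_tendsto_div`), proved for
nonnegative `f` by monotone interpolation between renewals and extended by splitting `f` into
positive and negative parts. For the central limit theorem (`Renewal.tendstoInDistribution`), the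
classical theorem is applied to a deterministic number of centred cycle sums. Replacing this number
by the true count costs a negligible error by an orthogonality estimate, and the delay and the
unfinished cycle are negligible after division by `√n`.

The variance is the variance of a cycle sum divided by the mean cycle length. Writing the square of
a partial sum as `∑ 2 u_k (S_k + u_k / 2)` makes the product `g F` appear, which gives the closed
form (`memLp_and_integral_cycleSum_sq`). -/

namespace ZigZag

/-! ### Finite words of states and the Markov property. -/

section Words

variable {S : Type*}

/-- The path `x` visits, right after time `t`, the states listed in the word `l`. -/
def Follows (x : ℕ → S) : ℕ → List S → Prop
  | _, [] => True
  | t, y :: l => x (t + 1) = y ∧ Follows x (t + 1) l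

@[simp] lemma follows_nil (x : ℕ → S) (t : ℕ) : Follows x t [] := trivial

@[simp] lemma follows_cons (x : ℕ → S) (t : ℕ) (y : S) (l : List S) :
    Follows x t (y :: l) ↔ x (t + 1) = y ∧ Follows x (t + 1) l := Iff.rfl

lemma follows_append (x : ℕ → S) (t : ℕ) (l l' : List S) :
    Follows x t (l ++ l') ↔ Follows x t l ∧ Follows x (t + l.length) l' := by
  induction l generalizing t with
  | nil => simp
  | cons y l ih => simp [ih, and_assoc, Nat.add_assoc, Nat.add_comm 1]

/-- The last state of a word read from the state `z`. -/
def endpoint : S → List S → S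
  | z, [] => z
  | _, y :: l => endpoint y l

@[simp] lemma endpoint_nil (z : S) : endpoint z [] = z := rfl

@[simp] lemma endpoint_cons (z y : S) (l : List S) : endpoint z (y :: l) = endpoint y l := rfl

lemma endpoint_append (z : S) (l l' : List S) :
    endpoint z (l ++ l') = endpoint (endpoint z l) l' := by
  induction l generalizing z with
  | nil => rfl
  | cons y l ih => simp [ih]

lemma Follows.endpoint {x : ℕ → S} {t : ℕ} {l : List S} (h : Follows x t l) :
    x (t + l.length) = endpoint (x t) l := by
  induction l generalizing t with
  | nil => rfl
  | cons y l ih =>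
    obtain ⟨h1, h2⟩ := h
    have := ih h2
    rw [h1] at this
    simpa [Nat.add_assoc, Nat.add_comm 1] using this

lemma Follows.sum_eq {x : ℕ → S} {t : ℕ} {l : List S} (h : Follows x t l) (f : S → ℝ) :
    ∑ i ∈ Finset.range l.length, f (x (t + 1 + i)) = (l.map f).sum := by
  induction l generalizing t with
  | nil => simp
  | cons y l ih =>
    obtain ⟨h1, h2⟩ := h
    have := ih h2
    rw [List.length_cons, Finset.sum_range_succ', List.map_cons, List.sum_cons, ← this, add_comm]
    simp [h1, Nat.add_comm, Nat.add_left_comm]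

variable [MeasurableSpace S]

/-- The probability that a chain with kernel `κ` follows the word `l` when started from `z`. -/
noncomputable def wordProb (κ : Kernel S S) : S → List S → ENNReal
  | _, [] => 1
  | z, y :: l => κ z {y} * wordProb κ y l

@[simp] lemma wordProb_nil (κ : Kernel S S) (z : S) : wordProb κ z [] = 1 := rfl

@[simp] lemma wordProb_cons (κ : Kernel S S) (z y : S) (l : List S) :
    wordProb κ z (y :: l) = κ z {y} * wordProb κ y l := rfl

lemma wordProb_append (κ : Kernel S S) (z : S) (l l' : List S) :
    wordProb κ z (l ++ l') = wordProb κ z l * wordProb κ (endpoint z l) l' := by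
  induction l generalizing z with
  | nil => simp
  | cons y l ih => simp [ih, mul_assoc]

variable {Ω : Type*} [MeasurableSpace Ω] {P : Measure Ω} {κ : Kernel S S} {X : ℕ → Ω → S}

/-- The event `A` depends only on the path of `X` up to time `n`. -/
def DependsUpTo (X : ℕ → Ω → S) (n : ℕ) (A : Set Ω) : Prop :=
  ∀ ω ω', (∀ k ≤ n, X k ω = X k ω') → ω ∈ A → ω' ∈ A

variable [MeasurableSingletonClass S]

lemma IsMarkovChain.measurableSet_follows (hX : IsMarkovChain P κ X) (t : ℕ) (l : List S) :
    MeasurableSet {ω | Follows (X · ω) t l} := by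
  induction l generalizing t with
  | nil => simp
  | cons y l ih => exact (hX.measurable (t + 1) (measurableSet_singleton y)).inter (ih (t + 1))

variable [Countable S]

/-- `IsMarkovChain` prescribes only the probabilities of full trajectories. As `S` is countable, `A
∩ {X n = z}` is a countable disjoint union of trajectory events, and the transition rule is summed
over them; measurability of `A` need not be assumed. -/
lemma IsMarkovChain.measure_inter_step (hX : IsMarkovChain P κ X) {n : ℕ} {A : Set Ω}
    (hA : DependsUpTo X n A) (z y : S) :
    P (A ∩ {ω | X n ω = z} ∩ {ω | X (n + 1) ω = y}) = P (A ∩ {ω | X n ω = z}) * κ z {y} := by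
  classical
  let ρ : Ω → (Fin (n + 1) → S) := fun ω i => X i ω
  have hρ : Measurable ρ := measurable_pi_lambda _ fun i => hX.measurable i
  let I : Set (Fin (n + 1) → S) := ρ '' (A ∩ {ω | X n ω = z})
  have hI : I.Countable := Set.to_countable I
  have hkey : ∀ {ω ω'}, ρ ω = ρ ω' → ∀ k ≤ n, X k ω = X k ω' := fun h k hk =>
    congrFun h ⟨k, Nat.lt_succ_of_le hk⟩
  have hunion : A ∩ {ω | X n ω = z} = ⋃ s ∈ I, ρ ⁻¹' {s} := by
    ext ω
    simp only [Set.mem_iUnion, Set.mem_preimage, Set.mem_singleton_iff, exists_prop]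
    constructor
    · intro h
      exact ⟨ρ ω, ⟨ω, h, rfl⟩, rfl⟩
    · rintro ⟨s, ⟨ω', h', rfl⟩, h⟩
      exact ⟨hA ω' ω (hkey h.symm) h'.1, by
        have := hkey h n le_rfl
        simpa [this] using h'.2⟩
  have hdisj : I.PairwiseDisjoint fun s => ρ ⁻¹' {s} := fun s _ s' _ hne =>
    Disjoint.preimage _ (by simpa using hne)
  have hdisj' : I.PairwiseDisjoint fun s => ρ ⁻¹' {s} ∩ {ω | X (n + 1) ω = y} :=
    fun s hs s' hs' hne => (hdisj hs hs' hne).mono Set.inter_subset_left Set.inter_subset_left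
  have hy : MeasurableSet {ω | X (n + 1) ω = y} := hX.measurable (n + 1) (measurableSet_singleton y)
  rw [hunion, Set.iUnion₂_inter, measure_biUnion hI hdisj' fun s _ =>
    (hρ (measurableSet_singleton s)).inter hy, measure_biUnion hI hdisj fun s _ =>
    hρ (measurableSet_singleton s), ← ENNReal.tsum_mul_right]
  refine tsum_congr fun s => ?_
  obtain ⟨_, ω', h', rfl⟩ := s
  have ht := hX.transition n fun k => if k ≤ n then X k ω' else y
  simp only [le_refl, if_true, Nat.not_succ_le_self, if_false] at ht
  have hz : X n ω' = z := h'.2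
  rw [hz] at ht
  have e1 : {ω | ∀ k ≤ n, X k ω = if k ≤ n then X k ω' else y} = ρ ⁻¹' {ρ ω'} := by
    ext ω
    simp only [Set.mem_ofPred_eq, Set.mem_preimage, Set.mem_singleton_iff]
    constructor
    · intro h
      funext i
      have := h i (Nat.le_of_lt_succ i.2)
      rwa [if_pos (Nat.le_of_lt_succ i.2)] at this
    · intro h k hk
      rw [if_pos hk]
      exact hkey h k hk
  have e2 : {ω | ∀ k ≤ n + 1, X k ω = if k ≤ n then X k ω' else y} =
      ρ ⁻¹' {ρ ω'} ∩ {ω | X (n + 1) ω = y} := by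
    rw [← e1]
    ext ω
    simp only [Set.mem_ofPred_eq, Set.mem_inter_iff]
    constructor
    · intro h
      exact ⟨fun k hk => h k (by omega), by simpa using h (n + 1) le_rfl⟩
    · rintro ⟨h1, h2⟩ k hk
      rcases Nat.lt_or_ge n k with hlt | hge
      · obtain rfl : k = n + 1 := by omega
        simpa using h2
      · exact h1 k hge
  rwa [e1, e2] at ht

/-- Markov property: after a visit to `z` at time `n`, a word is followed with probability
`wordProb κ z l`, independently of the past. -/
lemma IsMarkovChain.measure_inter_follows (hX : IsMarkovChain P κ X) {n : ℕ} {A : Set Ω}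
    (hA : DependsUpTo X n A) (z : S) (l : List S) :
    P (A ∩ {ω | X n ω = z} ∩ {ω | Follows (X · ω) n l}) =
      P (A ∩ {ω | X n ω = z}) * wordProb κ z l := by
  induction l generalizing n A z with
  | nil => simp
  | cons y l ih =>
    have hA' : DependsUpTo X (n + 1) (A ∩ {ω | X n ω = z}) := fun ω ω' h hω =>
      ⟨hA ω ω' (fun k hk => h k (by omega)) hω.1, by
        have := h n (by omega)
        simpa [← this] using hω.2⟩
    have := ih hA' y
    rw [hX.measure_inter_step hA, mul_assoc] at this
    rw [wordProb_cons, ← this]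
    congr 1
    ext ω
    simp [and_assoc]

/-- If the words of a family are mutually exclusive and their probabilities from `z` sum to one,
then almost surely every visit to `z` is followed by one of these words. -/
lemma IsMarkovChain.ae_exists_follows [IsFiniteMeasure P] (hX : IsMarkovChain P κ X) {ι : Type*}
    [Countable ι] (z : S) (l : ι → List S)
    (hl : ∀ (x : ℕ → S) t i j, Follows x t (l i) → Follows x t (l j) → i = j)
    (hsum : ∑' i, wordProb κ z (l i) = 1) :
    ∀ᵐ ω ∂P, ∀ t, X t ω = z → ∃ i, Follows (X · ω) t (l i) := by
  rw [ae_all_iff]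
  intro t
  have hmz : MeasurableSet {ω | X t ω = z} := hX.measurable t (measurableSet_singleton z)
  have hm : ∀ i, MeasurableSet ({ω | X t ω = z} ∩ {ω | Follows (X · ω) t (l i)}) := fun i =>
    hmz.inter (hX.measurableSet_follows t (l i))
  have h1 : P (⋃ i, {ω | X t ω = z} ∩ {ω | Follows (X · ω) t (l i)}) = P {ω | X t ω = z} := by
    rw [measure_iUnion _ hm]
    · have : ∀ i, P ({ω | X t ω = z} ∩ {ω | Follows (X · ω) t (l i)}) =
          P {ω | X t ω = z} * wordProb κ z (l i) := fun i => by
        simpa using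
          hX.measure_inter_follows (A := Set.univ) (n := t) (fun _ _ _ _ => trivial) z (l i)
      simp_rw [this]
      rw [ENNReal.tsum_mul_left, hsum, mul_one]
    · intro i j hij
      refine Set.disjoint_left.2 fun ω h h' => hij (hl _ t i j h.2 h'.2)
  -- The union is contained in `{X t = z}` and has the same finite measure, so the two agree almost
  -- everywhere.
  have h2 := ae_eq_of_subset_of_measure_ge (μ := P)
    (Set.iUnion_subset fun i => Set.inter_subset_left) h1.ge
    (MeasurableSet.iUnion hm).nullMeasurableSet (measure_ne_top _ _)
  filter_upwards [h2] with ω hω hz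
  have : (⋃ i, {ω | X t ω = z} ∩ {ω | Follows (X · ω) t (l i)}) ω := by
    rw [hω]; exact hz
  obtain ⟨i, hi⟩ := Set.mem_iUnion.1 this
  exact ⟨i, hi.2⟩

end Words

/-! ### Telescoping and the Gibbs weight along the half-lines. -/

lemma hasSum_sub_succ_of_antitone {q : ℕ → ℝ} (hq : Antitone q) (h0 : Tendsto q atTop (𝓝 0)) :
    HasSum (fun n => q n - q (n + 1)) (q 0) := by
  rw [hasSum_iff_tendsto_nat_of_nonneg fun n => sub_nonneg.2 (hq n.le_succ)]
  simp_rw [Finset.sum_range_sub']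
  simpa using h0.const_sub (q 0)

section Gibbs

variable {U : ℤ → ℝ}

lemma partition_pos (hZ : Summable fun x : ℤ => Real.exp (-U x)) : 0 < partition U :=
  hZ.tsum_pos (fun _ => (Real.exp_pos _).le) 0 (Real.exp_pos _)

lemma gibbs_pos (hZ : Summable fun x : ℤ => Real.exp (-U x)) (x : ℤ) : 0 < gibbs U x :=
  div_pos (Real.exp_pos _) (partition_pos hZ)

lemma hasSum_gibbs (hZ : Summable fun x : ℤ => Real.exp (-U x)) : HasSum (gibbs U) 1 := by
  have := hZ.hasSum.div_const (partition U)
  rwa [← partition, div_self (partition_pos hZ).ne'] at this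

/-- The sign `v` parametrises both half-lines as `k * v` with `k : ℕ`, so that each later argument
is made once for the two sides. -/
lemma gibbs_antitone_ray (hZ : Summable fun x : ℤ => Real.exp (-U x))
    (hdec : AntitoneOn U (Set.Iic 0)) (hinc : MonotoneOn U (Set.Ici 0)) (v : ℤˣ) :
    Antitone fun k : ℕ => gibbs U (k * v) := by
  refine antitone_nat_of_succ_le fun k => ?_
  refine div_le_div_of_nonneg_right (Real.exp_le_exp.2 (neg_le_neg ?_)) (partition_pos hZ).le
  rcases Int.units_eq_one_or v with rfl | rfl
  · refine hinc ?_ ?_ ?_ <;> simp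
    omega
  · refine hdec ?_ ?_ ?_ <;> simp

lemma ray_injective (v : ℤˣ) : Function.Injective fun k : ℕ => (k * v : ℤ) := fun a b h => by
  have : (v : ℤ) ≠ 0 := v.ne_zero
  simpa [this] using h

lemma summable_gibbs_ray (hZ : Summable fun x : ℤ => Real.exp (-U x)) (v : ℤˣ) :
    Summable fun k : ℕ => gibbs U (k * v) :=
  (hasSum_gibbs hZ).summable.comp_injective (ray_injective v)

lemma tendsto_gibbs_ray (hZ : Summable fun x : ℤ => Real.exp (-U x)) (v : ℤˣ) :
    Tendsto (fun k : ℕ => gibbs U (k * v)) atTop (𝓝 0) :=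
  (summable_gibbs_ray hZ v).tendsto_atTop_zero

lemma kernel_move (U : ℤ → ℝ) (x : ℤ) (v : ℤˣ) :
    kernel U (x, v) {(x + v, v)} = ENNReal.ofReal (moveProb U (x, v)) := by
  have : v ≠ -v := by rcases Int.units_eq_one_or v with rfl | rfl <;> decide
  simp [kernel, Kernel.ofFunOfCountable, this.symm]

lemma kernel_flip (U : ℤ → ℝ) (x : ℤ) (v : ℤˣ) :
    kernel U (x, v) {(x, -v)} = ENNReal.ofReal (1 - moveProb U (x, v)) := by
  have : v ≠ -v := by rcases Int.units_eq_one_or v with rfl | rfl <;> decide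
  simp [kernel, Kernel.ofFunOfCountable, this]

lemma moveProb_outward (hZ : Summable fun x : ℤ => Real.exp (-U x))
    (hdec : AntitoneOn U (Set.Iic 0)) (hinc : MonotoneOn U (Set.Ici 0)) (v : ℤˣ) (k : ℕ) :
    moveProb U ((k : ℤ) * v, v) = gibbs U ((k + 1 : ℕ) * v) / gibbs U (k * v) := by
  have := gibbs_antitone_ray hZ hdec hinc v k.le_succ
  rw [moveProb, min_eq_left]
  · push_cast; ring_nf
  · rw [div_le_one (gibbs_pos hZ _)]
    convert this using 2
    push_cast; ring

/-- Towards the origin the weight does not decrease, so the minimum is `1`: the way back is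
deterministic. -/
lemma moveProb_inward (hZ : Summable fun x : ℤ => Real.exp (-U x))
    (hdec : AntitoneOn U (Set.Iic 0)) (hinc : MonotoneOn U (Set.Ici 0)) (v : ℤˣ) (k : ℕ) :
    moveProb U ((k + 1 : ℕ) * v, -v) = 1 := by
  have := gibbs_antitone_ray hZ hdec hinc v k.le_succ
  rw [moveProb, min_eq_right]
  rw [one_le_div (gibbs_pos hZ _)]
  convert this using 2
  push_cast; ring

end Gibbs

/-! ### Excursions and cycles as words, with their sums and probabilities. -/

section Excursions

/-- The states visited when returning to the origin from `(k v, -v)`. -/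
def descent (v : ℤˣ) : ℕ → List State
  | 0 => []
  | k + 1 => ((k : ℤ) * v, -v) :: descent v k

/-- The states visited after `(k v, v)` when the walk makes `n` more steps outwards, turns around
and returns to the origin. -/
def excursion (v : ℤˣ) : ℕ → ℕ → List State
  | k, 0 => ((k : ℤ) * v, -v) :: descent v k
  | k, n + 1 => ((k + 1 : ℕ) * v, v) :: excursion v (k + 1) n

/-- The states visited after `(0, 1)` during the cycle that reaches `c.1` and then `-c.2`. -/
def cycle (c : ℕ × ℕ) : List State := excursion 1 0 c.1 ++ excursion (-1) 0 c.2

lemma endpoint_descent (v : ℤˣ) (k : ℕ) : endpoint ((k : ℤ) * v, -v) (descent v k) = (0, -v) := by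
  induction k with
  | zero => simp [descent]
  | succ k ih => simpa [descent] using ih

lemma endpoint_excursion (v : ℤˣ) (k n : ℕ) (z : State) :
    endpoint z (excursion v k n) = (0, -v) := by
  induction n generalizing k z with
  | zero => simpa [excursion] using endpoint_descent v k
  | succ n ih => simpa [excursion] using ih _ _

lemma endpoint_cycle (c : ℕ × ℕ) (z : State) : endpoint z (cycle c) = (0, 1) := by
  simp [cycle, endpoint_append, endpoint_excursion]

/-- The first reversal of the velocity reveals the number of outward steps, so different excursion
words exclude each other. -/
lemma Follows.excursion_unique {x : ℕ → State} {t : ℕ} {v : ℤˣ} {k n n' : ℕ}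
    (h : Follows x t (excursion v k n)) (h' : Follows x t (excursion v k n')) : n = n' := by
  have hv : v ≠ -v := by rcases Int.units_eq_one_or v with rfl | rfl <;> decide
  induction n generalizing k n' t with
  | zero =>
    cases n' with
    | zero => rfl
    | succ n' => exact absurd (congrArg Prod.snd (h'.1.symm.trans h.1)) hv
  | succ n ih =>
    cases n' with
    | zero => exact absurd (congrArg Prod.snd (h.1.symm.trans h'.1)) hv
    | succ n' => rw [ih h.2 h'.2]

lemma Follows.cycle_unique {x : ℕ → State} {t : ℕ} {c c' : ℕ × ℕ}
    (h : Follows x t (cycle c)) (h' : Follows x t (cycle c')) : c = c' := by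
  rw [cycle, follows_append] at h h'
  have h1 := h.1.excursion_unique h'.1
  have h2 := h.2
  rw [h1] at h2
  exact Prod.ext h1 (h2.excursion_unique h'.2)

lemma sum_descent (f : State → ℝ) (v : ℤˣ) (k : ℕ) :
    ((descent v k).map f).sum = ∑ i ∈ Finset.range k, f (i * v, -v) := by
  induction k with
  | zero => simp [descent]
  | succ k ih => rw [descent, List.map_cons, List.sum_cons, ih, Finset.sum_range_succ, add_comm]

/-- The word begins after `(k v, v)`, so sites up to `k v` are met only on the way back, while each
further site is met with both velocities. -/
lemma sum_excursion (f : State → ℝ) (v : ℤˣ) (k n : ℕ) :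
    ((excursion v k n).map f).sum = ∑ i ∈ Finset.range (k + 1), f (i * v, -v) +
      ∑ i ∈ Finset.range n,
        (f ((k + i + 1 : ℕ) * v, v) + f ((k + i + 1 : ℕ) * v, -v)) := by
  induction n generalizing k with
  | zero =>
    rw [excursion, List.map_cons, List.sum_cons, sum_descent, Finset.sum_range_succ, add_comm]
    simp
  | succ n ih =>
    rw [excursion, List.map_cons, List.sum_cons, ih, Finset.sum_range_succ' _ n,
      Finset.sum_range_succ _ (k + 1)]
    have : ∀ i, k + 1 + i + 1 = k + (i + 1) + 1 := fun i => by ring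
    simp only [this, add_zero]
    ring

lemma g_units (f : State → ℝ) (x : ℤ) (v : ℤˣ) : f (x, v) + f (x, -v) = g f x := by
  rcases Int.units_eq_one_or v with rfl | rfl
  · rfl
  · simp [g, add_comm]

/-- The sum of `f` over a cycle. -/
def cycleSum (f : State → ℝ) (c : ℕ × ℕ) : ℝ :=
  g f 0 + ∑ i ∈ Finset.range c.1, g f (i + 1) + ∑ i ∈ Finset.range c.2, g f (-(i + 1))

/-- The two excursions of a cycle return to the origin with opposite velocities, which produces the
term `g f 0`. -/
lemma sum_cycle (f : State → ℝ) (c : ℕ × ℕ) : ((cycle c).map f).sum = cycleSum f c := by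
  rw [cycle, List.map_append, List.sum_append, sum_excursion, sum_excursion]
  simp_rw [g_units]
  simp [cycleSum, g]
  ring

lemma length_cycle (c : ℕ × ℕ) : ((cycle c).length : ℝ) = cycleSum (fun _ => 1) c := by
  rw [← sum_cycle]
  simp

lemma length_cycle_pos (c : ℕ × ℕ) : 0 < (cycle c).length := by
  rcases c with ⟨_ | a, b⟩ <;> simp [cycle, excursion]

variable {U : ℤ → ℝ}

lemma wordProb_descent (hZ : Summable fun x : ℤ => Real.exp (-U x))
    (hdec : AntitoneOn U (Set.Iic 0)) (hinc : MonotoneOn U (Set.Ici 0)) (v : ℤˣ) (k : ℕ) :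
    wordProb (kernel U) ((k : ℤ) * v, -v) (descent v k) = 1 := by
  induction k with
  | zero => rfl
  | succ k ih =>
    have h := kernel_move U ((k + 1 : ℕ) * v) (-v)
    have e : ((k + 1 : ℕ) * v + (-v : ℤˣ) : ℤ) = k * v := by push_cast; ring
    rw [e, moveProb_inward hZ hdec hinc, ENNReal.ofReal_one] at h
    rw [descent, wordProb_cons, h, ih, one_mul]

/-- The ratios of the `n` outward steps telescope to `π((k+n)v) / π(kv)`, the turn costs `1 -
π((k+n+1)v) / π((k+n)v)`, and the descent has probability one. -/
lemma wordProb_excursion (hZ : Summable fun x : ℤ => Real.exp (-U x))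
    (hdec : AntitoneOn U (Set.Iic 0)) (hinc : MonotoneOn U (Set.Ici 0)) (v : ℤˣ) (k n : ℕ) :
    wordProb (kernel U) ((k : ℤ) * v, v) (excursion v k n) =
      ENNReal.ofReal ((gibbs U ((k + n : ℕ) * v) - gibbs U ((k + (n + 1) : ℕ) * v)) /
        gibbs U (k * v)) := by
  induction n generalizing k with
  | zero =>
    rw [excursion, wordProb_cons, wordProb_descent hZ hdec hinc, kernel_flip,
      moveProb_outward hZ hdec hinc, mul_one, one_sub_div (gibbs_pos hZ _).ne']
    simp
  | succ n ih =>
    have h := kernel_move U (k * v) v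
    have e : ((k : ℕ) * v + v : ℤ) = (k + 1 : ℕ) * v := by push_cast; ring
    rw [e, moveProb_outward hZ hdec hinc] at h
    rw [excursion, wordProb_cons, h, ih, ← ENNReal.ofReal_mul
      (div_nonneg (gibbs_pos hZ _).le (gibbs_pos hZ _).le)]
    congr 1
    have e1 : k + 1 + n = k + (n + 1) := by ring
    have e2 : k + 1 + (n + 1) = k + (n + 1 + 1) := by ring
    have := (gibbs_pos hZ ((k + 1 : ℕ) * v)).ne'
    rw [e1, e2]
    field_simp

lemma tsum_wordProb_excursion (hZ : Summable fun x : ℤ => Real.exp (-U x))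
    (hdec : AntitoneOn U (Set.Iic 0)) (hinc : MonotoneOn U (Set.Ici 0)) (v : ℤˣ) (k : ℕ) :
    ∑' n, wordProb (kernel U) ((k : ℤ) * v, v) (excursion v k n) = 1 := by
  simp_rw [wordProb_excursion hZ hdec hinc]
  have hanti : Antitone fun n : ℕ => gibbs U ((k + n : ℕ) * v) := fun a b h =>
    gibbs_antitone_ray hZ hdec hinc v (Nat.add_le_add_left h k)
  have h0 : Tendsto (fun n : ℕ => gibbs U ((k + n : ℕ) * v)) atTop (𝓝 0) := by
    have := (tendsto_add_atTop_iff_nat k).2 (tendsto_gibbs_ray hZ v)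
    simpa only [add_comm] using this
  have hs := (hasSum_sub_succ_of_antitone hanti h0).div_const (gibbs U (k * v))
  rw [← ENNReal.ofReal_tsum_of_nonneg (fun n => div_nonneg (sub_nonneg.2 (hanti n.le_succ))
    (gibbs_pos hZ _).le) hs.summable, hs.tsum_eq]
  simp [(gibbs_pos hZ (k * v)).ne']

/-- The probability of a cycle started from `(0, 1)`. -/
lemma wordProb_cycle (U : ℤ → ℝ) (c : ℕ × ℕ) :
    wordProb (kernel U) (0, 1) (cycle c) =
      wordProb (kernel U) (0, 1) (excursion 1 0 c.1) *
        wordProb (kernel U) (0, -1) (excursion (-1) 0 c.2) := by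
  rw [cycle, wordProb_append, endpoint_excursion]

lemma tsum_wordProb_cycle (hZ : Summable fun x : ℤ => Real.exp (-U x))
    (hdec : AntitoneOn U (Set.Iic 0)) (hinc : MonotoneOn U (Set.Ici 0)) :
    ∑' c, wordProb (kernel U) (0, 1) (cycle c) = 1 := by
  simp_rw [wordProb_cycle]
  rw [ENNReal.tsum_prod']
  simp_rw [ENNReal.tsum_mul_left, ENNReal.tsum_mul_right]
  have h1 := tsum_wordProb_excursion hZ hdec hinc 1 0
  have h2 := tsum_wordProb_excursion hZ hdec hinc (-1) 0
  simp only [Nat.cast_zero, zero_mul] at h1 h2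
  rw [h1, h2, one_mul]

variable {Ω : Type*} [MeasurableSpace Ω] {P : Measure Ω} [IsProbabilityMeasure P]
  {X : ℕ → Ω → State}

/-- Every state either points away from the origin, and is then inside an excursion, or points
towards it, and is then inside a descent. -/
lemma exists_ray (x : ℤ) (v : ℤˣ) : ∃ k : ℕ, (x, v) = ((k : ℤ) * v, v) ∨
    ∃ w : ℤˣ, (x, v) = ((k : ℤ) * w, -w) := by
  refine ⟨x.natAbs, ?_⟩
  rcases Int.units_eq_one_or v with rfl | rfl <;> rcases Int.natAbs_eq x with h | h
  · left; simpa using h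
  · right; exact ⟨-1, by simpa using h⟩
  · right; exact ⟨1, by simpa using h⟩
  · left; simpa using h

/-- Almost surely the walk visits `(0, 1)`, and every such visit is followed by a cycle. -/
lemma ae_exists_cycle (hZ : Summable fun x : ℤ => Real.exp (-U x))
    (hdec : AntitoneOn U (Set.Iic 0)) (hinc : MonotoneOn U (Set.Ici 0))
    (hX : IsMarkovChain P (kernel U) X) :
    ∀ᵐ ω ∂P, (∃ t, X t ω = (0, 1)) ∧
      ∀ t, X t ω = (0, 1) → ∃ c, Follows (X · ω) t (cycle c) := by
  have h1 : ∀ᵐ ω ∂P, ∀ (v : ℤˣ) (k : ℕ), ∀ t, X t ω = ((k : ℤ) * v, v) →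
      ∃ n, Follows (X · ω) t (excursion v k n) :=
    ae_all_iff.2 fun v => ae_all_iff.2 fun k => hX.ae_exists_follows _ _
      (fun x t i j => Follows.excursion_unique) (tsum_wordProb_excursion hZ hdec hinc v k)
  -- A descent is a single word of probability one, hence a family indexed by `Unit`.
  have h2 : ∀ᵐ ω ∂P, ∀ (v : ℤˣ) (k : ℕ), ∀ t, X t ω = ((k : ℤ) * v, -v) →
      ∃ _ : Unit, Follows (X · ω) t (descent v k) :=
    ae_all_iff.2 fun v => ae_all_iff.2 fun k => hX.ae_exists_follows _ _
      (fun x t i j _ _ => rfl) (by simpa using wordProb_descent hZ hdec hinc v k)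
  have h3 := hX.ae_exists_follows (0, 1) cycle (fun x t i j => Follows.cycle_unique)
    (tsum_wordProb_cycle hZ hdec hinc)
  filter_upwards [h1, h2, h3] with ω h1 h2 h3
  refine ⟨?_, h3⟩
  have hexc : ∀ t (v : ℤˣ) (k : ℕ), X t ω = ((k : ℤ) * v, v) → ∃ t', X t' ω = (0, -v) := by
    intro t v k h
    obtain ⟨n, hn⟩ := h1 v k t h
    exact ⟨_, hn.endpoint.trans (endpoint_excursion v k n _)⟩
  -- Any starting state leads to the origin; if the velocity there is `-1`, one further excursion to
  -- the left leads to `(0, 1)`.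
  have hzero : ∃ t v, X t ω = (0, v) := by
    obtain ⟨k, h | ⟨w, h⟩⟩ := exists_ray (X 0 ω).1 (X 0 ω).2
    · obtain ⟨t, ht⟩ := hexc 0 _ k h
      exact ⟨t, _, ht⟩
    · obtain ⟨-, hd⟩ := h2 w k 0 h
      refine ⟨_, -w, hd.endpoint.trans ?_⟩
      rw [show X 0 ω = ((k : ℤ) * w, -w) from h, endpoint_descent]
  obtain ⟨t, v, ht⟩ := hzero
  rcases Int.units_eq_one_or v with rfl | rfl
  · exact ⟨t, ht⟩
  · simpa using hexc t (-1) 0 (by simpa using ht)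

end Excursions

/-! ### Counting functions of increasing sequences, deterministic part. -/

section Counting

/-- The number of terms of the strictly increasing sequence `T` which are at most `n`. -/
noncomputable def count (T : ℕ → ℕ) (n : ℕ) : ℕ := sInf {j | n < T j}

variable {T : ℕ → ℕ}

lemma lt_count_iff (hT : StrictMono T) {j n : ℕ} : j < count T n ↔ T j ≤ n := by
  have hne : {j | n < T j}.Nonempty := ⟨n + 1, Nat.lt_of_lt_of_le n.lt_succ_self (hT.le_apply)⟩
  constructor
  · intro h
    exact not_lt.1 fun hn => absurd h (not_lt.2 (Nat.sInf_le hn))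
  · intro h
    by_contra hc
    have h1 : n < T (count T n) := Nat.sInf_mem hne
    exact absurd (h1.trans_le (hT.monotone (not_lt.1 hc))) (not_lt.2 h)

lemma count_le (hT : StrictMono T) (n : ℕ) : count T n ≤ n + 1 :=
  Nat.sInf_le (Nat.lt_of_lt_of_le n.lt_succ_self hT.le_apply)

lemma count_mono (hT : StrictMono T) : Monotone (count T) := fun a b hab => by
  by_contra hc
  exact absurd (((lt_count_iff hT).1 (not_le.1 hc)).trans hab)
    (not_le.2 (not_le.1 fun h => lt_irrefl _ ((lt_count_iff hT).2 h)))

lemma count_apply (hT : StrictMono T) (j : ℕ) : count T (T j) = j + 1 := by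
  refine le_antisymm ?_ ((lt_count_iff hT).2 le_rfl)
  by_contra hc
  have := (lt_count_iff hT).1 (not_le.1 hc)
  exact absurd (hT j.lt_succ_self) (not_lt.2 this)

lemma tendsto_count (hT : StrictMono T) : Tendsto (count T) atTop atTop := by
  refine tendsto_atTop.2 fun K => ?_
  filter_upwards [eventually_ge_atTop (T K)] with n hn
  exact ((lt_count_iff hT).2 hn).le

/-- A monotone sequence whose averages converge along `T` has converging averages. -/
lemma tendsto_div_of_monotone (hT : StrictMono T) {ℓ r : ℝ} (hℓ : 0 < ℓ)
    (hTℓ : Tendsto (fun j => (T j : ℝ) / j) atTop (𝓝 ℓ)) {s : ℕ → ℝ} (hs : Monotone s)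
    (h0 : 0 ≤ s 0) (hr : Tendsto (fun j => s (T j) / j) atTop (𝓝 r)) :
    Tendsto (fun n => s n / n) atTop (𝓝 (r / ℓ)) := by
  have hone : Tendsto (fun j : ℕ => ((j + 1 : ℕ) : ℝ) / j) atTop (𝓝 1) := by
    have h1 : Tendsto (fun j : ℕ => 1 + 1 / (j : ℝ)) atTop (𝓝 (1 + 0)) :=
      tendsto_const_nhds.add tendsto_one_div_atTop_nhds_zero_nat
    rw [add_zero] at h1
    refine h1.congr' ?_
    filter_upwards [eventually_gt_atTop 0] with j hj
    have : (j : ℝ) ≠ 0 := by positivity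
    field_simp
    push_cast; ring
  have hsucc : ∀ {u : ℕ → ℝ} {a : ℝ}, Tendsto (fun j => u j / j) atTop (𝓝 a) →
      Tendsto (fun j => u (j + 1) / j) atTop (𝓝 a) := by
    intro u a hu
    have := ((tendsto_add_atTop_iff_nat 1).2 hu).mul hone
    rw [mul_one] at this
    refine this.congr fun j => ?_
    have : ((j + 1 : ℕ) : ℝ) ≠ 0 := by positivity
    field_simp
  have hdiv : ∀ {u w : ℕ → ℝ} {a : ℝ}, Tendsto (fun j => u j / j) atTop (𝓝 a) →
      Tendsto (fun j => w j / j) atTop (𝓝 ℓ) → Tendsto (fun j => u j / w j) atTop (𝓝 (a / ℓ)) := by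
    intro u w a hu hw
    refine (hu.div hw hℓ.ne').congr' ?_
    filter_upwards [eventually_gt_atTop 0] with j hj
    have : (j : ℝ) ≠ 0 := by positivity
    simp only [Pi.div_apply]
    field_simp
  -- With `N = count T n`, one has `T (N - 1) ≤ n < T N` for large `n`, so `s n / n` lies between `s
  -- (T (N - 1)) / T N` and `s (T N) / T (N - 1)`; both bounds tend to `r / ℓ`.
  have hm : Tendsto (fun n => count T n - 1) atTop atTop :=
    (tendsto_sub_atTop_nat 1).comp (tendsto_count hT)
  have hlow := (hdiv hr (hsucc hTℓ)).comp hm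
  have hupp := (hdiv (hsucc hr) hTℓ).comp hm
  have hev : ∀ᶠ n in atTop, 0 < T (count T n - 1) ∧ T (count T n - 1) ≤ n ∧
      n < T (count T n - 1 + 1) := by
    filter_upwards [eventually_ge_atTop (T 0), hm.eventually_ge_atTop 1] with n hn h1
    have hpos : 0 < count T n := (lt_count_iff hT).2 hn
    refine ⟨lt_of_lt_of_le h1 hT.le_apply, (lt_count_iff hT).1 (by omega), not_le.1 fun h => ?_⟩
    have := (lt_count_iff hT).2 h
    omega
  have hnn : ∀ n, 0 ≤ s n := fun n => h0.trans (hs n.zero_le)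
  refine tendsto_of_tendsto_of_tendsto_of_le_of_le' hlow hupp ?_ ?_
  · filter_upwards [hev] with n ⟨h1, h2, h3⟩
    exact div_le_div₀ (hnn _) (hs h2) (by exact_mod_cast h1.trans_le h2) (by exact_mod_cast h3.le)
  · filter_upwards [hev] with n ⟨h1, h2, h3⟩
    exact div_le_div₀ (hnn _) (hs h3.le) (by exact_mod_cast h1) (by exact_mod_cast h2)

/-- Two initial segments of `ℕ` differ in `|a - b|` elements. This evaluates the second moment when
a random number of cycles is replaced by a deterministic one. -/
lemma sum_ite_sub_ite_sq {a b N : ℕ} (ha : a ≤ N) (hb : b ≤ N) :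
    ∑ j ∈ Finset.range N, (((if j < a then 1 else 0) - (if j < b then 1 else 0) : ℝ)) ^ 2 =
      |(a : ℝ) - b| := by
  have h1 : ∀ c ≤ N, ∑ j ∈ Finset.range N, (if j < c then 1 else 0 : ℝ) = c := by
    intro c hc
    rw [← Finset.sum_filter, Finset.sum_const, nsmul_eq_mul, mul_one]
    congr 1
    have : (Finset.range N).filter (· < c) = Finset.range c := by
      ext j
      simp only [Finset.mem_filter, Finset.mem_range]
      omega
    rw [this, Finset.card_range]
  rcases le_total a b with hab | hab
  · rw [abs_of_nonpos (sub_nonpos.2 (by exact_mod_cast hab)), neg_sub, ← h1 a ha, ← h1 b hb,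
      ← Finset.sum_sub_distrib]
    refine Finset.sum_congr rfl fun j _ => ?_
    split_ifs with h2 h3 <;> first | omega | norm_num
  · rw [abs_of_nonneg (sub_nonneg.2 (by exact_mod_cast hab)), ← h1 a ha, ← h1 b hb,
      ← Finset.sum_sub_distrib]
    refine Finset.sum_congr rfl fun j _ => ?_
    split_ifs with h2 h3 <;> first | omega | norm_num

lemma eq_sum_of_succ {u r : ℕ → ℝ} (hu : ∀ j, u (j + 1) = u j + r j) (j : ℕ) :
    u j = u 0 + ∑ i ∈ Finset.range j, r i := by
  induction j with
  | zero => simp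
  | succ j ih => rw [hu, ih, Finset.sum_range_succ, add_assoc]

lemma tendsto_div_of_succ {u r : ℕ → ℝ} {a : ℝ} (hu : ∀ j, u (j + 1) = u j + r j)
    (hr : Tendsto (fun n : ℕ => (∑ i ∈ Finset.range n, r i) / n) atTop (𝓝 a)) :
    Tendsto (fun j : ℕ => u j / j) atTop (𝓝 a) := by
  have := (tendsto_const_div_atTop_nhds_zero_nat (u 0)).add hr
  rw [zero_add] at this
  refine this.congr fun j => ?_
  rw [eq_sum_of_succ hu j, add_div]

end Counting

/-! ### Delayed renewal processes: independence of the marks and law of large numbers. -/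

section Renewal

/-- Two outcomes share the initial delay and the first `m` marks. -/
def PastEq {Ω C : Type*} (T : ℕ → Ω → ℕ) (Y : ℕ → Ω → C) (m : ℕ) (ω ω' : Ω) : Prop :=
  T 0 ω = T 0 ω' ∧ ∀ i < m, Y i ω = Y i ω'

lemma PastEq.mono {Ω C : Type*} {T : ℕ → Ω → ℕ} {Y : ℕ → Ω → C} {m m' : ℕ}
    (hm : m ≤ m') {ω ω' : Ω} (h : PastEq T Y m' ω ω') :
    PastEq T Y m ω ω' := ⟨h.1, fun i hi => h.2 i (hi.trans_le hm)⟩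

variable {Ω C : Type*} [MeasurableSpace Ω] [MeasurableSpace C] {P : Measure Ω} {ν : Measure C}
  {len : C → ℕ} {T : ℕ → Ω → ℕ} {Y : ℕ → Ω → C}

/-- A delayed renewal process with renewal times `T j` and marks `Y j`: the marks are independent
with law `ν`, independent of `T 0`, and the mark `Y j` determines the length of the `j`-th cycle. -/
structure Renewal (P : Measure Ω) (ν : Measure C) (len : C → ℕ) (T : ℕ → Ω → ℕ)
    (Y : ℕ → Ω → C) : Prop where
  measurable_zero : Measurable (T 0)
  measurable_mark : ∀ j, Measurable (Y j)
  len_pos : ∀ c, 0 < len c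
  succ : ∀ j ω, T (j + 1) ω = T j ω + len (Y j ω)
  law : ∀ m t (c : ℕ → C), P {ω | T 0 ω = t ∧ ∀ i < m, Y i ω = c i} =
    P {ω | T 0 ω = t} * ∏ i ∈ Finset.range m, ν {c i}

namespace Renewal

lemma strictMono (h : Renewal P ν len T Y) (ω : Ω) : StrictMono fun j => T j ω :=
  strictMono_nat_of_lt_succ fun j => by
    have := h.len_pos (Y j ω)
    rw [h.succ]
    omega

lemma time_eq (h : Renewal P ν len T Y) {m : ℕ} {ω ω' : Ω} (hω : PastEq T Y m ω ω') :
    T m ω = T m ω' := by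
  induction m with
  | zero => exact hω.1
  | succ m ih =>
    rw [h.succ, h.succ, ih (hω.mono m.le_succ), hω.2 m m.lt_succ_self]

lemma one_le_integral_len [IsProbabilityMeasure ν] (h : Renewal P ν len T Y)
    (hlen : Integrable (fun c => (len c : ℝ)) ν) : 1 ≤ ∫ c, (len c : ℝ) ∂ν := by
  have := integral_mono (μ := ν) (integrable_const (1 : ℝ)) hlen fun c =>
    Nat.one_le_cast.2 (h.len_pos c)
  simpa using this

lemma measure_history_inter (h : Renewal P ν len T Y) (m : ℕ) (x : ℕ × (Fin m → C)) (c : C) :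
    P ((fun ω => (T 0 ω, fun i : Fin m => Y i ω)) ⁻¹' {x} ∩ Y m ⁻¹' {c}) =
      P ((fun ω => (T 0 ω, fun i : Fin m => Y i ω)) ⁻¹' {x}) * ν {c} := by
  classical
  obtain ⟨t, d⟩ := x
  -- The prescribed history extended by `c`: the value at index `m` is the new mark, later ones are
  -- irrelevant.
  let d' : ℕ → C := fun i => if hi : i < m then d ⟨i, hi⟩ else c
  have hd : ∀ i (hi : i < m), d' i = d ⟨i, hi⟩ := fun i hi => dif_pos hi
  have hc : d' m = c := dif_neg (lt_irrefl m)
  have e1 : (fun ω => (T 0 ω, fun i : Fin m => Y i ω)) ⁻¹' {(t, d)} =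
      {ω | T 0 ω = t ∧ ∀ i < m, Y i ω = d' i} := by
    ext ω
    simp only [Set.mem_preimage, Set.mem_singleton_iff, Prod.mk.injEq, Set.mem_ofPred_eq,
      funext_iff]
    refine and_congr_right fun _ => ⟨fun hh i hi => ?_, fun hh i => ?_⟩
    · rw [hd i hi, ← hh ⟨i, hi⟩]
    · rw [hh i i.2, hd i i.2]
  have e2 : {ω | T 0 ω = t ∧ ∀ i < m, Y i ω = d' i} ∩ Y m ⁻¹' {c} =
      {ω | T 0 ω = t ∧ ∀ i < m + 1, Y i ω = d' i} := by
    ext ω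
    simp only [Set.mem_inter_iff, Set.mem_preimage, Set.mem_singleton_iff, Set.mem_ofPred_eq,
      and_assoc, Nat.forall_lt_succ_right, hc]
  rw [e1, e2, h.law, h.law, Finset.prod_range_succ, hc, mul_assoc]

variable [Countable C] [MeasurableSingletonClass C]

/-- The delay and the first `m` marks take countably many values, so every function of them is
measurable. -/
lemma measurable_of_past (h : Renewal P ν len T Y) {E : Type*} [MeasurableSpace E] [Nonempty E]
    {m : ℕ} {φ : Ω → E} (hφ : ∀ ω ω', PastEq T Y m ω ω' → φ ω = φ ω') : Measurable φ := by
  let H : Ω → ℕ × (Fin m → C) := fun ω => (T 0 ω, fun i => Y i ω)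
  have hH : Measurable H :=
    h.measurable_zero.prodMk (measurable_pi_lambda _ fun i => h.measurable_mark i)
  have hf : Function.FactorsThrough φ H := fun ω ω' hω => hφ ω ω'
    ⟨congrArg Prod.fst hω, fun i hi => congrFun (congrArg Prod.snd hω) ⟨i, hi⟩⟩
  have : φ = Function.extend H φ (fun _ => Classical.arbitrary E) ∘ H :=
    funext fun ω => (hf.extend_apply _ ω).symm
  rw [this]
  exact (measurable_of_countable _).comp hH

lemma measurable_time (h : Renewal P ν len T Y) (j : ℕ) : Measurable (T j) :=
  h.measurable_of_past fun _ _ => h.time_eq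

lemma measure_past_inter_singleton (h : Renewal P ν len T Y) {m : ℕ} {A : Set Ω}
    (hA : ∀ ω ω', PastEq T Y m ω ω' → ω ∈ A → ω' ∈ A) (c : C) :
    P (A ∩ Y m ⁻¹' {c}) = P A * ν {c} := by
  let H : Ω → ℕ × (Fin m → C) := fun ω => (T 0 ω, fun i => Y i ω)
  have hH : Measurable H :=
    h.measurable_zero.prodMk (measurable_pi_lambda _ fun i => h.measurable_mark i)
  have hAH : A = ⋃ x ∈ H '' A, H ⁻¹' {x} := by
    ext ω
    simp only [Set.mem_iUnion, exists_prop, Set.mem_preimage, Set.mem_singleton_iff]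
    refine ⟨fun hω => ⟨_, ⟨ω, hω, rfl⟩, rfl⟩, ?_⟩
    rintro ⟨_, ⟨ω', hω', rfl⟩, hω⟩
    exact hA ω' ω ⟨(congrArg Prod.fst hω).symm, fun i hi =>
      (congrFun (congrArg Prod.snd hω) ⟨i, hi⟩).symm⟩ hω'
  have hdisj : (H '' A).PairwiseDisjoint fun x => H ⁻¹' {x} := fun x _ x' _ hne =>
    Disjoint.preimage _ (by simpa using hne)
  rw [hAH, Set.iUnion₂_inter, measure_biUnion (Set.to_countable _)
    (fun x hx x' hx' hne => (hdisj hx hx' hne).mono Set.inter_subset_left Set.inter_subset_left)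
    fun x _ => (hH (measurableSet_singleton x)).inter
      (h.measurable_mark m (measurableSet_singleton c)),
    measure_biUnion (Set.to_countable _) hdisj fun x _ => hH (measurableSet_singleton x),
    ← ENNReal.tsum_mul_right]
  exact tsum_congr fun x => h.measure_history_inter m x c

lemma measurableSet_of_past (h : Renewal P ν len T Y) {m : ℕ} {A : Set Ω}
    (hA : ∀ ω ω', PastEq T Y m ω ω' → ω ∈ A → ω' ∈ A) : MeasurableSet A := by
  have : Measurable fun ω => ω ∈ A := h.measurable_of_past fun ω ω' hω => propext
    ⟨hA ω ω' hω, hA ω' ω ⟨hω.1.symm, fun i hi => (hω.2 i hi).symm⟩⟩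
  exact measurableSet_setOfPred.2 this

lemma measurable_reward (h : Renewal P ν len T Y) (R : C → ℝ) (j : ℕ) :
    Measurable fun ω => R (Y j ω) := (measurable_of_countable R).comp (h.measurable_mark j)

/-- Both sides are measures in `B` on a countable space, so the case of singletons suffices. -/
lemma measure_past_inter (h : Renewal P ν len T Y) {m : ℕ} {A : Set Ω}
    (hA : ∀ ω ω', PastEq T Y m ω ω' → ω ∈ A → ω' ∈ A) (B : Set C) :
    P (A ∩ Y m ⁻¹' B) = P A * ν B := by
  have hmA := h.measurableSet_of_past hA
  have : (P.restrict A).map (Y m) = P A • ν := by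
    refine Measure.ext_of_singleton fun c => ?_
    rw [Measure.map_apply (h.measurable_mark m) (measurableSet_singleton c),
      Measure.restrict_apply (h.measurable_mark m (measurableSet_singleton c)), Set.inter_comm,
      h.measure_past_inter_singleton hA]
    rfl
  have hB := congrArg (fun μ : Measure C => μ B) this
  have hmB : MeasurableSet B := B.to_countable.measurableSet
  simp only [Measure.map_apply (h.measurable_mark m) hmB,
    Measure.restrict_apply (h.measurable_mark m hmB)] at hB
  rw [Set.inter_comm, hB]
  rfl

variable [IsProbabilityMeasure P]

lemma map_mark (h : Renewal P ν len T Y) (m : ℕ) : P.map (Y m) = ν := by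
  refine Measure.ext_of_singleton fun c => ?_
  rw [Measure.map_apply (h.measurable_mark m) (measurableSet_singleton c)]
  simpa using h.measure_past_inter_singleton (m := m) (A := Set.univ) (fun _ _ _ _ => trivial) c

lemma indepFun_past (h : Renewal P ν len T Y) {E : Type*} [MeasurableSpace E]
    {m : ℕ} {φ : Ω → E} (hφ : ∀ ω ω', PastEq T Y m ω ω' → φ ω = φ ω') : φ ⟂ᵢ[P] Y m := by
  rw [indepFun_iff_measure_inter_preimage_eq_mul]
  intro s t _ ht
  rw [h.measure_past_inter (A := φ ⁻¹' s) fun ω ω' hω hs => by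
    rwa [Set.mem_preimage, ← hφ ω ω' hω]]
  rw [← h.map_mark m, Measure.map_apply (h.measurable_mark m) ht]

/-- Induction on the largest index `a`: the event about the smaller indices belongs to the past of
the mark `Y a`. -/
lemma iIndepFun_mark (h : Renewal P ν len T Y) : iIndepFun Y P := by
  rw [iIndepFun_iff_measure_inter_preimage_eq_mul]
  intro S
  induction S using Finset.induction_on_max with
  | empty => simp
  | insert a S ha ih =>
    intro B hB
    have haS : a ∉ S := fun hh => lt_irrefl a (ha a hh)
    rw [Finset.prod_insert haS, ← ih fun i hi => hB i (Finset.mem_insert_of_mem hi),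
      Finset.set_biInter_insert, Set.inter_comm, h.measure_past_inter, mul_comm,
      ← h.map_mark a, Measure.map_apply (h.measurable_mark a) (hB a (Finset.mem_insert_self _ _))]
    intro ω ω' hω hmem
    simp only [Set.mem_iInter, Set.mem_preimage] at hmem ⊢
    intro i hi
    rw [← hω.2 i (ha i hi)]
    exact hmem i hi

lemma identDistrib_reward (h : Renewal P ν len T Y) (R : C → ℝ) (j : ℕ) :
    IdentDistrib (fun ω => R (Y j ω)) (fun ω => R (Y 0 ω)) P P :=
  (IdentDistrib.mk (h.measurable_mark j).aemeasurable (h.measurable_mark 0).aemeasurable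
    (by rw [h.map_mark, h.map_mark])).comp (measurable_of_countable R)

lemma iIndepFun_reward (h : Renewal P ν len T Y) (R : C → ℝ) :
    iIndepFun (fun j ω => R (Y j ω)) P :=
  h.iIndepFun_mark.comp (fun _ => R) fun _ => measurable_of_countable R

lemma integral_reward (h : Renewal P ν len T Y) (R : C → ℝ) (j : ℕ) :
    ∫ ω, R (Y j ω) ∂P = ∫ c, R c ∂ν := by
  rw [← h.map_mark j, integral_map (h.measurable_mark j).aemeasurable
    (measurable_of_countable R).aestronglyMeasurable]

lemma memLp_reward (h : Renewal P ν len T Y) {R : C → ℝ} {p : ENNReal} (hR : MemLp R p ν) (j : ℕ) :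
    MemLp (fun ω => R (Y j ω)) p P := by
  rw [← h.map_mark j] at hR
  exact hR.comp_of_map (h.measurable_mark j).aemeasurable

/-- The strong law of large numbers for the rewards of a renewal process. -/
lemma ae_tendsto_reward (h : Renewal P ν len T Y) {R : C → ℝ} (hR : Integrable R ν) :
    ∀ᵐ ω ∂P, Tendsto (fun n : ℕ => (∑ i ∈ Finset.range n, R (Y i ω)) / n) atTop
      (𝓝 (∫ c, R c ∂ν)) := by
  have := strong_law_ae_real (fun j ω => R (Y j ω))
    (memLp_one_iff_integrable.1 (h.memLp_reward (memLp_one_iff_integrable.2 hR) 0))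
    (fun i j hij => (h.iIndepFun_reward R).indepFun hij) (h.identDistrib_reward R)
  rwa [h.integral_reward R 0] at this

variable [IsProbabilityMeasure ν]

/-- The renewal-reward theorem: law of large numbers. -/
theorem ae_tendsto_div (h : Renewal P ν len T Y) (hlen : Integrable (fun c => (len c : ℝ)) ν)
    {R : C → ℝ} (hR : Integrable R ν) {s : Ω → ℕ → ℝ}
    (hs : ∀ᵐ ω ∂P, Monotone (s ω) ∧ 0 ≤ s ω 0 ∧
      ∀ j, s ω (T (j + 1) ω) = s ω (T j ω) + R (Y j ω)) :
    ∀ᵐ ω ∂P, Tendsto (fun n : ℕ => s ω n / n) atTop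
      (𝓝 ((∫ c, R c ∂ν) / ∫ c, (len c : ℝ) ∂ν)) := by
  filter_upwards [hs, h.ae_tendsto_reward hR, h.ae_tendsto_reward hlen] with ω ⟨h1, h2, h3⟩ h4 h5
  refine tendsto_div_of_monotone (h.strictMono ω)
    (zero_lt_one.trans_le (h.one_le_integral_len hlen)) ?_ h1 h2
    (tendsto_div_of_succ (u := fun j => s ω (T j ω)) h3 h4)
  exact tendsto_div_of_succ (u := fun j => (T j ω : ℝ))
    (fun j => by rw [h.succ]; push_cast; rfl) h5

lemma ae_tendsto_count (h : Renewal P ν len T Y) (hlen : Integrable (fun c => (len c : ℝ)) ν) :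
    ∀ᵐ ω ∂P, Tendsto (fun n : ℕ => (count (fun j => T j ω) n : ℝ) / n) atTop
      (𝓝 (1 / ∫ c, (len c : ℝ) ∂ν)) := by
  have := h.ae_tendsto_div hlen (R := fun _ => 1) (integrable_const _)
    (s := fun ω n => (count (fun j => T j ω) n : ℝ)) (Eventually.of_forall fun ω =>
      ⟨fun a b hab => Nat.cast_le.2 (count_mono (h.strictMono ω) hab), Nat.cast_nonneg _,
        fun j => by
          rw [count_apply (h.strictMono ω), count_apply (h.strictMono ω)]
          push_cast
          ring⟩)
  simpa using this

end Renewal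
end Renewal

/-! ### Random sums: orthogonality, replacement of the count, and the straddling cycle. -/

namespace Renewal

variable {Ω C : Type*} [MeasurableSpace Ω] [MeasurableSpace C] {P : Measure Ω} {ν : Measure C}
  {len : C → ℕ} {T : ℕ → Ω → ℕ} {Y : ℕ → Ω → C}
  [Countable C] [MeasurableSingletonClass C]

lemma measurable_count (h : Renewal P ν len T Y) (n : ℕ) :
    Measurable fun ω => count (fun j => T j ω) n := by
  refine measurable_of_Ioi fun k => ?_
  have : (fun ω => count (fun j => T j ω) n) ⁻¹' Set.Ioi k = T k ⁻¹' Set.Iic n := by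
    ext ω
    exact lt_count_iff (h.strictMono ω)
  rw [this]
  exact h.measurable_time k measurableSet_Iic

lemma measurable_sum_count (h : Renewal P ν len T Y) (R : C → ℝ) (n : ℕ) :
    Measurable fun ω => ∑ j ∈ Finset.range (count (fun j => T j ω) n), R (Y j ω) := by
  have h1 : Measurable fun p : ℕ × Ω => ∑ j ∈ Finset.range p.1, R (Y j p.2) :=
    measurable_from_prod_countable_right fun k =>
      Finset.measurable_fun_sum (Finset.range k) fun j _ => h.measurable_reward R j
  exact h1.comp ((h.measurable_count n).prodMk measurable_id)

variable [IsProbabilityMeasure P]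

/-- Orthogonality: the second moment of a sum of centred rewards with predictable bounded
coefficients. -/
lemma memLp_and_integral_sq_sum (h : Renewal P ν len T Y) {R : C → ℝ} (hR : MemLp R 2 ν)
    (hR0 : ∫ c, R c ∂ν = 0) {a : ℕ → Ω → ℝ}
    (ha : ∀ j ω ω', PastEq T Y j ω ω' → a j ω = a j ω') (ha1 : ∀ j ω, |a j ω| ≤ 1) (N : ℕ) :
    MemLp (fun ω => ∑ j ∈ Finset.range N, a j ω * R (Y j ω)) 2 P ∧
      ∫ ω, (∑ j ∈ Finset.range N, a j ω * R (Y j ω)) ^ 2 ∂P =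
        (∫ c, R c ^ 2 ∂ν) * ∫ ω, ∑ j ∈ Finset.range N, a j ω ^ 2 ∂P := by
  have hma : ∀ j, Measurable (a j) := fun j => h.measurable_of_past (ha j)
  have hRj : ∀ j, MemLp (fun ω => R (Y j ω)) 2 P := h.memLp_reward hR
  have haR : ∀ j, MemLp (fun ω => a j ω * R (Y j ω)) 2 P := fun j =>
    (hRj j).of_le ((hma j).mul (h.measurable_reward R j)).aestronglyMeasurable
      (Eventually.of_forall fun ω => by
        rw [norm_mul]
        exact mul_le_of_le_one_left (norm_nonneg _) (ha1 j ω))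
  have ha2 : ∀ j, Integrable (fun ω => a j ω ^ 2) P := fun j =>
    Integrable.of_bound ((hma j).pow_const 2).aestronglyMeasurable 1
      (Eventually.of_forall fun ω => by
        rw [Real.norm_eq_abs, abs_pow]
        exact pow_le_one₀ (abs_nonneg _) (ha1 j ω))
  have hL : ∀ N, MemLp (fun ω => ∑ j ∈ Finset.range N, a j ω * R (Y j ω)) 2 P := fun N =>
    memLp_finsetSum _ fun j _ => haR j
  refine ⟨hL N, ?_⟩
  induction N with
  | zero => simp
  | succ N ih =>
    set W : Ω → ℝ := fun ω => ∑ j ∈ Finset.range N, a j ω * R (Y j ω) with hW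
    have hWa : ∀ ω ω', PastEq T Y N ω ω' → W ω * a N ω = W ω' * a N ω' := fun ω ω' hω => by
      rw [ha N ω ω' hω, hW]
      congr 1
      refine Finset.sum_congr rfl fun j hj => ?_
      have hj := Finset.mem_range.1 hj
      rw [ha j ω ω' (hω.mono hj.le), hω.2 j hj]
    -- `W * a N` is a function of the past, hence independent of the centred reward `R (Y N)`.
    have hcross : ∫ ω, W ω * a N ω * R (Y N ω) ∂P = 0 := by
      have hind : (fun ω => W ω * a N ω) ⟂ᵢ[P] (fun ω => R (Y N ω)) :=
        (h.indepFun_past hWa).comp measurable_id (measurable_of_countable R)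
      rw [hind.integral_fun_mul_eq_mul_integral (h.measurable_of_past hWa).aestronglyMeasurable
        (h.measurable_reward R N).aestronglyMeasurable, h.integral_reward, hR0, mul_zero]
    have hsq : ∫ ω, a N ω ^ 2 * R (Y N ω) ^ 2 ∂P = (∫ ω, a N ω ^ 2 ∂P) * ∫ c, R c ^ 2 ∂ν := by
      have hind : (fun ω => a N ω ^ 2) ⟂ᵢ[P] (fun ω => R (Y N ω) ^ 2) :=
        (h.indepFun_past (ha N)).comp (φ := fun x => x ^ 2) (measurable_id.pow_const 2)
          (measurable_of_countable fun c => R c ^ 2)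
      rw [hind.integral_fun_mul_eq_mul_integral ((hma N).pow_const 2).aestronglyMeasurable
        ((h.measurable_reward R N).pow_const 2).aestronglyMeasurable,
        h.integral_reward fun c => R c ^ 2]
    have hi1 : Integrable (fun ω => W ω ^ 2) P := (hL N).integrable_sq
    have hi2 : Integrable (fun ω => 2 * (W ω * a N ω * R (Y N ω))) P := by
      have := ((hL N).integrable_mul (haR N)).const_mul 2
      refine this.congr (Eventually.of_forall fun ω => ?_)
      simp only [Pi.mul_apply, hW]
      ring
    have hi3 : Integrable (fun ω => a N ω ^ 2 * R (Y N ω) ^ 2) P := by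
      refine (haR N).integrable_sq.congr (Eventually.of_forall fun ω => ?_)
      simp only
      ring
    have e : ∀ ω, (∑ j ∈ Finset.range (N + 1), a j ω * R (Y j ω)) ^ 2 =
        W ω ^ 2 + 2 * (W ω * a N ω * R (Y N ω)) + a N ω ^ 2 * R (Y N ω) ^ 2 := fun ω => by
      rw [Finset.sum_range_succ]
      ring
    simp_rw [e]
    have hi12 : Integrable (fun ω => W ω ^ 2 + 2 * (W ω * a N ω * R (Y N ω))) P := hi1.add hi2
    rw [integral_add hi12 hi3, integral_add hi1 hi2, integral_const_mul, hcross, hsq, ih]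
    simp_rw [Finset.sum_range_succ]
    rw [integral_add (integrable_finsetSum _ fun j _ => ha2 j) (ha2 N)]
    ring

/-- Up to a negligible error, the number of renewals can be replaced by its mean in the sum of the
rewards (Anscombe's theorem). -/
lemma tendstoInMeasure_sum_count_sub [IsProbabilityMeasure ν] (h : Renewal P ν len T Y)
    (hlen : Integrable (fun c => (len c : ℝ)) ν) {R : C → ℝ} (hR : MemLp R 2 ν)
    (hR0 : ∫ c, R c ∂ν = 0) :
    TendstoInMeasure P (fun (n : ℕ) ω => (1 / √n) *
      (∑ j ∈ Finset.range (count (fun j => T j ω) n), R (Y j ω) -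
        ∑ j ∈ Finset.range ⌊n / ∫ c, (len c : ℝ) ∂ν⌋₊, R (Y j ω))) atTop 0 := by
  set ℓ := ∫ c, (len c : ℝ) ∂ν with hℓ
  have hℓ1 : 1 ≤ ℓ := h.one_le_integral_len hlen
  let m : ℕ → ℕ := fun n => ⌊n / ℓ⌋₊
  -- `T j ≤ n` means `j < count`, and it is decided by the delay and the first `j` marks. The
  -- difference of the two sums is thus a sum with predictable coefficients `a n j`, and only
  -- indices `j ≤ n` matter.
  let a : ℕ → ℕ → Ω → ℝ := fun n j ω => (if T j ω ≤ n then 1 else 0) - (if j < m n then 1 else 0)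
  have hm : ∀ n, m n ≤ n + 1 := fun n => by
    have : (n : ℝ) / ℓ ≤ n := div_le_self (Nat.cast_nonneg _) hℓ1
    exact (Nat.floor_le_of_le this).trans n.le_succ
  have ha : ∀ n j ω ω', PastEq T Y j ω ω' → a n j ω = a n j ω' := fun n j ω ω' hω => by
    simp only [a, h.time_eq hω]
  have ha1 : ∀ n j ω, |a n j ω| ≤ 1 := fun n j ω => by
    simp only [a]
    split_ifs <;> norm_num
  have hcount : ∀ n j ω, T j ω ≤ n ↔ j < count (fun j => T j ω) n := fun n j ω =>
    (lt_count_iff (h.strictMono ω)).symm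
  have hsum : ∀ n ω, ∑ j ∈ Finset.range (n + 1), a n j ω * R (Y j ω) =
      ∑ j ∈ Finset.range (count (fun j => T j ω) n), R (Y j ω) -
        ∑ j ∈ Finset.range (m n), R (Y j ω) := fun n ω => by
    have hfil : ∀ k ≤ n + 1, ∑ j ∈ Finset.range (n + 1), (if j < k then 1 else 0) * R (Y j ω) =
        ∑ j ∈ Finset.range k, R (Y j ω) := fun k hk => by
      simp_rw [ite_mul, one_mul, zero_mul]
      rw [← Finset.sum_filter]
      congr 1
      ext j
      simp only [Finset.mem_filter, Finset.mem_range]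
      omega
    simp only [a, hcount, sub_mul, Finset.sum_sub_distrib]
    rw [hfil _ (count_le (h.strictMono ω) n), hfil _ (hm n)]
  have hsq : ∀ n ω, ∑ j ∈ Finset.range (n + 1), a n j ω ^ 2 =
      |(count (fun j => T j ω) n : ℝ) - m n| := fun n ω => by
    simp only [a, hcount]
    exact sum_ite_sub_ite_sq (count_le (h.strictMono ω) n) (hm n)
  -- Both `count / n` and `m n / n` tend to `1 / ℓ`, and their difference is bounded by `2`, so
  -- dominated convergence applies.
  have hlim : Tendsto (fun n : ℕ => ∫ ω, |(count (fun j => T j ω) n : ℝ) - m n| / n ∂P) atTop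
      (𝓝 0) := by
    have hmn : Tendsto (fun n : ℕ => (m n : ℝ) / n) atTop (𝓝 (1 / ℓ)) := by
      have := (tendsto_nat_floor_mul_div_atTop (R := ℝ) (a := 1 / ℓ) (by positivity)).comp
        tendsto_natCast_atTop_atTop
      refine this.congr fun n => ?_
      simp only [Function.comp_apply, m]
      rw [one_div_mul_eq_div]
    have := tendsto_integral_of_dominated_convergence (μ := P)
      (F := fun (n : ℕ) ω => |(count (fun j => T j ω) n : ℝ) - m n| / n) (f := fun _ => 0)
      (fun _ => 2) (fun n => ?_) (integrable_const _) (fun n => ?_) ?_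
    · simpa using this
    · exact (((measurable_of_countable (fun k : ℕ => (k : ℝ))).comp
        (h.measurable_count n)).sub_const _).abs.div_const _ |>.aestronglyMeasurable
    · refine Eventually.of_forall fun ω => ?_
      rw [Real.norm_eq_abs, abs_div, abs_abs, Nat.abs_cast]
      rcases Nat.eq_zero_or_pos n with rfl | hn
      · simp
      have hn' : (1 : ℝ) ≤ n := by exact_mod_cast hn
      rw [div_le_iff₀ (by positivity)]
      have h1 : (count (fun j => T j ω) n : ℝ) ≤ n + 1 := by
        exact_mod_cast count_le (h.strictMono ω) n
      have h2 : (m n : ℝ) ≤ n + 1 := by exact_mod_cast hm n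
      have h3 : (0 : ℝ) ≤ m n := Nat.cast_nonneg _
      have h4 : (0 : ℝ) ≤ count (fun j => T j ω) n := Nat.cast_nonneg _
      rw [abs_le]
      constructor <;> linarith
    · filter_upwards [h.ae_tendsto_count hlen] with ω hω
      have := (hω.sub hmn).abs
      rw [sub_self, abs_zero] at this
      refine this.congr fun n => ?_
      rw [← sub_div, abs_div, Nat.abs_cast]
  rw [tendstoInMeasure_iff_measureReal_norm]
  intro ε hε
  have hub : Tendsto (fun n : ℕ => (∫ c, R c ^ 2 ∂ν) / ε ^ 2 *
      ∫ ω, |(count (fun j => T j ω) n : ℝ) - m n| / n ∂P) atTop (𝓝 0) := by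
    simpa using hlim.const_mul ((∫ c, R c ^ 2 ∂ν) / ε ^ 2)
  refine squeeze_zero' (Eventually.of_forall fun n => measureReal_nonneg) ?_ hub
  filter_upwards [eventually_gt_atTop 0] with n hn
  obtain ⟨hL, hI⟩ := h.memLp_and_integral_sq_sum hR hR0 (ha n) (ha1 n) (n + 1)
  have hn' : (0 : ℝ) < n := by exact_mod_cast hn
  -- Chebyshev's inequality; by orthogonality the second moment is `∫ R²` times the mean of `|count
  -- - m n|`, which is `o(n)`.
  have hcheb := mul_meas_ge_le_integral_of_nonneg (μ := P)
    (f := fun ω => (∑ j ∈ Finset.range (n + 1), a n j ω * R (Y j ω)) ^ 2)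
    (Eventually.of_forall fun ω => sq_nonneg _) hL.integrable_sq (ε ^ 2 * n)
  rw [hI] at hcheb
  simp_rw [hsq] at hcheb
  rw [integral_div, div_mul_div_comm, le_div_iff₀ (by positivity), mul_comm]
  refine le_trans (le_of_eq ?_) hcheb
  congr 2
  ext ω
  simp only [Set.mem_ofPred_eq, Pi.zero_apply, sub_zero]
  rw [hsum, Real.norm_eq_abs, ← sq_le_sq₀ hε.le (abs_nonneg _), sq_abs, mul_pow, div_pow,
    Real.sq_sqrt hn'.le, one_pow, one_div_mul_eq_div, le_div_iff₀ hn']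

/-- The probability that the cycle straddling time `n` has its mark in `B` is at most
`∑_{c ∈ B} len c * ν {c}`. -/
lemma measure_straddle_le (h : Renewal P ν len T Y) (n : ℕ) (B : Set C) :
    P {ω | ∃ j, T j ω ≤ n ∧ n < T (j + 1) ω ∧ Y j ω ∈ B} ≤
      ∫⁻ c, B.indicator (fun c => (len c : ENNReal)) c ∂ν := by
  classical
  -- Here `t` is the end of the straddling cycle, one of the `len c` integers following `n`.
  have hsub : {ω | ∃ j, T j ω ≤ n ∧ n < T (j + 1) ω ∧ Y j ω ∈ B} ⊆
      ⋃ c ∈ B, ⋃ t ∈ Finset.Ioc (n : ℤ) (n + len c), ⋃ j,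
        ({ω | (T j ω : ℤ) + len c = t} ∩ Y j ⁻¹' {c}) := by
    rintro ω ⟨j, h1, h2, h3⟩
    rw [h.succ] at h2
    simp only [Set.mem_iUnion, Finset.mem_Ioc, Set.mem_inter_iff, Set.mem_ofPred_eq,
      Set.mem_preimage, Set.mem_singleton_iff]
    exact ⟨Y j ω, h3, T j ω + len (Y j ω), ⟨by omega, by omega⟩, j, rfl, rfl⟩
  -- For fixed `c` and `t`, strict monotonicity of `T` allows at most one `j` with `T j + len c =
  -- t`, so these events are disjoint and their probabilities add up to at most one.
  have hone : ∀ c (t : ℤ), P (⋃ j, ({ω | (T j ω : ℤ) + len c = t} ∩ Y j ⁻¹' {c})) ≤ ν {c} := by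
    intro c t
    have hmeas : ∀ j, MeasurableSet {ω | (T j ω : ℤ) + len c = t} := fun j =>
      
      h.measurable_time j (Set.to_countable {k : ℕ | (k : ℤ) + len c = t}).measurableSet
    calc P (⋃ j, ({ω | (T j ω : ℤ) + len c = t} ∩ Y j ⁻¹' {c}))
        ≤ ∑' j, P ({ω | (T j ω : ℤ) + len c = t} ∩ Y j ⁻¹' {c}) := measure_iUnion_le _
      _ = ∑' j, P {ω | (T j ω : ℤ) + len c = t} * ν {c} := by
          refine tsum_congr fun j => h.measure_past_inter_singleton (fun ω ω' hω hmem => ?_) c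
          rw [Set.mem_ofPred_eq] at hmem ⊢
          rwa [← h.time_eq hω]
      _ = P (⋃ j, {ω | (T j ω : ℤ) + len c = t}) * ν {c} := by
          rw [ENNReal.tsum_mul_right, measure_iUnion _ hmeas]
          intro i j hij
          refine Set.disjoint_left.2 fun ω h1 h2 => hij ((h.strictMono ω).injective ?_)
          simp only [Set.mem_ofPred_eq] at h1 h2
          show T i ω = T j ω
          omega
      _ ≤ 1 * ν {c} := by gcongr; exact prob_le_one
      _ = ν {c} := one_mul _
  calc P {ω | ∃ j, T j ω ≤ n ∧ n < T (j + 1) ω ∧ Y j ω ∈ B}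
      ≤ P (⋃ c ∈ B, ⋃ t ∈ Finset.Ioc (n : ℤ) (n + len c), ⋃ j,
        ({ω | (T j ω : ℤ) + len c = t} ∩ Y j ⁻¹' {c})) := measure_mono hsub
    _ ≤ ∑' c : B, P (⋃ t ∈ Finset.Ioc (n : ℤ) (n + len c), ⋃ j,
        ({ω | (T j ω : ℤ) + len c = t} ∩ Y j ⁻¹' {(c : C)})) :=
        measure_biUnion_le _ B.to_countable _
    _ ≤ ∑' c : B, (len c : ENNReal) * ν {(c : C)} := by
        refine ENNReal.tsum_le_tsum fun c => (measure_biUnion_finset_le _ _).trans ?_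
        refine (Finset.sum_le_sum fun t _ => hone c t).trans (le_of_eq ?_)
        simp
    _ = ∫⁻ c, B.indicator (fun c => (len c : ENNReal)) c ∂ν := by
        rw [tsum_subtype B fun c => (len c : ENNReal) * ν {c}, lintegral_countable']
        refine tsum_congr fun c => ?_
        by_cases hc : c ∈ B <;> simp [hc]

/-- A functional of the cycle straddling time `n` is tight. -/
lemma tendsto_measure_straddle (h : Renewal P ν len T Y)
    (hlen : Integrable (fun c => (len c : ℝ)) ν) (B : C → ℝ) {K : ℕ → ℝ}
    (hK : Tendsto K atTop atTop) :
    Tendsto (fun n => P {ω | ∃ j, T j ω ≤ n ∧ n < T (j + 1) ω ∧ K n ≤ B (Y j ω)}) atTop (𝓝 0) := by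
  -- `len` is an integrable majorant, and for each fixed `c` the indicator vanishes as soon as `K n
  -- > B c`.
  have hlim : Tendsto (fun n => ∫⁻ c, {c | K n ≤ B c}.indicator (fun c => (len c : ENNReal)) c ∂ν)
      atTop (𝓝 (∫⁻ _, 0 ∂ν)) := by
    refine tendsto_lintegral_of_dominated_convergence (fun c => (len c : ENNReal))
      (fun n => measurable_of_countable _) (fun n => Eventually.of_forall fun c =>
        Set.indicator_le_self _ _ c) ?_ (Eventually.of_forall fun c => ?_)
    · have := hlen.2
      rw [hasFiniteIntegral_iff_norm] at this
      refine ne_of_lt (lt_of_eq_of_lt (lintegral_congr fun c => ?_) this)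
      simp
    · refine tendsto_const_nhds.congr' ?_
      filter_upwards [hK.eventually_gt_atTop (B c)] with n hn
      rw [Set.indicator_of_notMem]
      exact not_le.2 hn
  rw [lintegral_zero] at hlim
  exact tendsto_of_tendsto_of_tendsto_of_le_of_le tendsto_const_nhds hlim (fun _ => zero_le)
    fun n => h.measure_straddle_le n {c | K n ≤ B c}

/-! ### The renewal-reward central limit theorem. -/

lemma tendstoInDistribution_comp_tendsto {Ω' E : Type*} [MeasurableSpace Ω'] [TopologicalSpace E]
    [MeasurableSpace E] [OpensMeasurableSpace E] {P' : Measure Ω'} [IsProbabilityMeasure P']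
    {X : ℕ → Ω → E} {Z : Ω' → E} (h : TendstoInDistribution X atTop Z (fun _ => P) P') {m : ℕ → ℕ}
    (hm : Tendsto m atTop atTop) :
    TendstoInDistribution (fun n => X (m n)) atTop Z (fun _ => P) P' :=
  ⟨fun n => h.forall_aemeasurable (m n), h.aemeasurable_limit, h.tendsto.comp hm⟩

/-- Realises the limit `N(0, v)` as `√ℓ * x` on the space carrying the target law `N(0, v / ℓ)`, so
that multiplication by `(√ℓ)⁻¹` leaves the identity. -/
lemma hasLaw_sqrt_mul {v ℓ : ℝ} (hv : 0 ≤ v) (hℓ : 0 < ℓ) :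
    HasLaw (fun x : ℝ => √ℓ * x) (gaussianReal 0 v.toNNReal) (gaussianReal 0 (v / ℓ).toNNReal) := by
  refine ⟨by fun_prop, ?_⟩
  rw [gaussianReal_map_const_mul, mul_zero]
  congr 1
  refine NNReal.eq ?_
  rw [NNReal.coe_mul, Real.coe_toNNReal _ hv, Real.coe_toNNReal _ (by positivity),
    NNReal.coe_mk, Real.sq_sqrt (by positivity)]
  field_simp

lemma tendstoInDistribution_inv_sqrt_mul_sum {Ω' : Type*} [MeasurableSpace Ω'] {P' : Measure Ω'}
    [IsProbabilityMeasure P'] {Z : Ω' → ℝ} (h : Renewal P ν len T Y) {R : C → ℝ}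
    (hR : MemLp R 2 ν) (hR0 : ∫ c, R c ∂ν = 0)
    (hZ : HasLaw Z (gaussianReal 0 (∫ c, R c ^ 2 ∂ν).toNNReal) P') :
    TendstoInDistribution (fun (n : ℕ) ω => (√n)⁻¹ * ∑ j ∈ Finset.range n, R (Y j ω)) atTop Z
      (fun _ => P) P' := by
  have hmean : ∫ ω, R (Y 0 ω) ∂P = 0 := by rw [h.integral_reward, hR0]
  have hvar : Var[fun ω => R (Y 0 ω); P] = ∫ c, R c ^ 2 ∂ν := by
    rw [variance_of_integral_eq_zero (h.measurable_reward R 0).aemeasurable hmean]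
    exact h.integral_reward (fun c => R c ^ 2) 0
  have := tendstoInDistribution_inv_sqrt_mul_sum_sub (X := fun j ω => R (Y j ω)) (P := P)
    (P' := P') (Y := Z) (by rw [hvar]; exact hZ) (h.memLp_reward hR 0)
    (h.iIndepFun_reward R) (h.identDistrib_reward R)
  refine this.congr (fun n => Eventually.of_forall fun ω => ?_) Filter.EventuallyEq.rfl
  simp [hmean]

/-- The central limit theorem along a deterministic number of cycles. -/
lemma tendstoInDistribution_sum_floor [IsProbabilityMeasure ν] (h : Renewal P ν len T Y)
    (hlen : Integrable (fun c => (len c : ℝ)) ν) {R : C → ℝ} (hR : MemLp R 2 ν)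
    (hR0 : ∫ c, R c ∂ν = 0) :
    TendstoInDistribution (fun (n : ℕ) ω => (1 / √n) *
      ∑ j ∈ Finset.range ⌊n / ∫ c, (len c : ℝ) ∂ν⌋₊, R (Y j ω)) atTop (id : ℝ → ℝ) (fun _ => P)
      (gaussianReal 0 ((∫ c, R c ^ 2 ∂ν) / ∫ c, (len c : ℝ) ∂ν).toNNReal) := by
  set ℓ := ∫ c, (len c : ℝ) ∂ν with hℓ
  have hℓ1 : 1 ≤ ℓ := h.one_le_integral_len hlen
  set v := ∫ c, R c ^ 2 ∂ν with hv
  have hv0 : 0 ≤ v := integral_nonneg fun c => sq_nonneg _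
  let m : ℕ → ℕ := fun n => ⌊n / ℓ⌋₊
  have hmtop : Tendsto m atTop atTop := tendsto_nat_floor_atTop.comp
    (tendsto_natCast_atTop_atTop.atTop_div_const (by positivity))
  have hclt := h.tendstoInDistribution_inv_sqrt_mul_sum hR hR0
    (hasLaw_sqrt_mul hv0 (zero_lt_one.trans_le hℓ1))
  have hclt' : TendstoInDistribution
      (fun (n : ℕ) ω => (√(m n : ℝ))⁻¹ * ∑ j ∈ Finset.range (m n), R (Y j ω)) atTop
      (fun x : ℝ => √ℓ * x) (fun _ => P) (gaussianReal 0 (v / ℓ).toNNReal) :=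
    tendstoInDistribution_comp_tendsto hclt hmtop
  have hmn : Tendsto (fun n : ℕ => √(m n : ℝ) / √n) atTop (𝓝 (√ℓ)⁻¹) := by
    have := (tendsto_nat_floor_mul_div_atTop (R := ℝ) (a := 1 / ℓ) (by positivity)).comp
      tendsto_natCast_atTop_atTop
    have := (Real.continuous_sqrt.tendsto _).comp this
    rw [one_div, Real.sqrt_inv] at this
    refine this.congr fun n => ?_
    simp only [Function.comp_apply, m]
    rw [inv_mul_eq_div, Real.sqrt_div (Nat.cast_nonneg _)]
  -- Slutsky's lemma changes the normalisation from `√(m n)` to `√n`, their quotient tending to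
  -- `(√ℓ)⁻¹`.
  have hslut := hclt'.continuous_comp_prodMk_of_tendstoInMeasure_const
    (g := fun p : ℝ × ℝ => p.1 * p.2) (by fun_prop)
    (Y := fun n _ => √(m n : ℝ) / √n) (c := (√ℓ)⁻¹)
    (tendstoInMeasure_of_tendsto_ae (fun n => aestronglyMeasurable_const)
      (Eventually.of_forall fun _ => hmn)) (fun n => aemeasurable_const)
  have hZ : (fun x : ℝ => (√ℓ * x) * (√ℓ)⁻¹) = id := by
    funext x
    have : √ℓ ≠ 0 := by positivity
    simp only [id]
    field_simp
  simp only at hslut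
  rw [hZ] at hslut
  refine hslut.congr (fun n => Eventually.of_forall fun ω => ?_) Filter.EventuallyEq.rfl
  change (√(m n : ℝ))⁻¹ * (∑ j ∈ Finset.range (m n), R (Y j ω)) * (√(m n : ℝ) / √n) =
    1 / √n * ∑ j ∈ Finset.range (m n), R (Y j ω)
  rcases Nat.eq_zero_or_pos (m n) with h0 | h0
  · simp [h0]
  · have : √(m n : ℝ) ≠ 0 := by positivity
    field_simp

/-- The contribution of the delay and of the incomplete last cycle is negligible. -/
lemma tendstoInMeasure_sub_sum_count [IsProbabilityMeasure ν] (h : Renewal P ν len T Y)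
    (hlen : Integrable (fun c => (len c : ℝ)) ν) (R : C → ℝ)
    {s : ℕ → Ω → ℝ} (hs : ∀ n, Measurable (s n))
    (hsum : ∀ᵐ ω ∂P, ∀ j, s (T (j + 1) ω) ω = s (T j ω) ω + R (Y j ω)) (B : C → ℝ)
    (hB : ∀ᵐ ω ∂P, ∀ j n, T j ω ≤ n → n < T (j + 1) ω → |s n ω - s (T j ω) ω| ≤ B (Y j ω)) :
    TendstoInMeasure P (fun (n : ℕ) ω => (1 / √n) *
      (s n ω - ∑ j ∈ Finset.range (count (fun j => T j ω) n), R (Y j ω))) atTop 0 := by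
  have hsqrt : Tendsto (fun n : ℕ => √(n : ℝ)) atTop atTop :=
    Real.tendsto_sqrt_atTop.comp tendsto_natCast_atTop_atTop
  have hTm := h.measurable_zero
  have hsT : Measurable fun ω => s (T 0 ω) ω := by
    have h1 : Measurable fun p : ℕ × Ω => s p.1 p.2 := measurable_from_prod_countable_right hs
    exact h1.comp (hTm.prodMk measurable_id)
  rw [tendstoInMeasure_iff_norm]
  intro ε hε
  -- The error is split in two halves of `ε`: one for the straddling cycle, one for the delay. The
  -- count includes the unfinished cycle with its full reward, whence `B + |R|` rather than `B`.
  have h1 : Tendsto (fun n : ℕ => P {ω | ∃ j, T j ω ≤ n ∧ n < T (j + 1) ω ∧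
      ε / 2 * √n ≤ B (Y j ω) + |R (Y j ω)|}) atTop (𝓝 0) :=
    h.tendsto_measure_straddle hlen (fun c => B c + |R c|)
      (hsqrt.const_mul_atTop (by positivity))
  have h2 : Tendsto (fun n : ℕ => P {ω | n < T 0 ω ∨ ε / 2 * √n ≤ |s (T 0 ω) ω|}) atTop (𝓝 0) := by
    have hae := tendstoInMeasure_of_tendsto_ae (μ := P)
      (f := fun (n : ℕ) ω => {ω | n < T 0 ω ∨ ε / 2 * √n ≤ |s (T 0 ω) ω|}.indicator
        (fun _ => (1 : ℝ)) ω) (g := fun _ => 0) (fun n => ?_) (Eventually.of_forall fun ω => ?_)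
    · have := (tendstoInMeasure_iff_norm.1 hae) 1 one_pos
      refine this.congr fun n => ?_
      congr 1
      ext ω
      rw [Set.mem_ofPred_eq, sub_zero]
      by_cases hω : ω ∈ {ω | n < T 0 ω ∨ ε / 2 * √n ≤ |s (T 0 ω) ω|}
      · simp [hω]
      · simp [hω]
    · exact (measurable_const.indicator ((hTm measurableSet_Ioi).union
        (measurableSet_le measurable_const hsT.abs))).aestronglyMeasurable
    · refine tendsto_const_nhds.congr' ?_
      filter_upwards [eventually_ge_atTop (T 0 ω),
        (hsqrt.const_mul_atTop (half_pos hε)).eventually_gt_atTop |s (T 0 ω) ω|] with n hn1 hn2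
      rw [Set.indicator_of_notMem]
      simp only [Set.mem_ofPred_eq, not_or, not_lt, not_le]
      exact ⟨hn1, hn2⟩
  have h12 := h1.add h2
  rw [add_zero] at h12
  refine tendsto_of_tendsto_of_tendsto_of_le_of_le' tendsto_const_nhds h12
    (Eventually.of_forall fun _ => zero_le) ?_
  filter_upwards [eventually_gt_atTop 0] with n hn
  refine (measure_mono_ae ?_).trans (measure_union_le _ _)
  filter_upwards [hsum, hB] with ω hω1 hω2 hmem
  by_contra hnot
  obtain ⟨ha, hb⟩ := not_or.1 hnot
  simp only [Set.mem_ofPred_eq, not_or, not_lt, not_le, not_exists, not_and] at ha hb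
  obtain ⟨hb1, hb2⟩ := hb
  have hpos : 0 < count (fun j => T j ω) n := (lt_count_iff (h.strictMono ω)).2 hb1
  -- The straddling cycle has index `count - 1`, since `count` includes the renewal that starts it.
  obtain ⟨j, hj⟩ : ∃ j, count (fun j => T j ω) n = j + 1 := ⟨_, (Nat.succ_pred_eq_of_pos hpos).symm⟩
  have hj1 : T j ω ≤ n := (lt_count_iff (h.strictMono ω)).1 (by omega)
  have hj2 : n < T (j + 1) ω := not_le.1 fun hle => by
    have := (lt_count_iff (h.strictMono ω) (j := j + 1)).2 hle
    omega
  have ha' := ha j hj1 hj2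
  have hB' := hω2 j n hj1 hj2
  have hsTj := eq_sum_of_succ (u := fun j => s (T j ω) ω) hω1 j
  have hn' : (0 : ℝ) < √n := Real.sqrt_pos.2 (by exact_mod_cast hn)
  have hmem' : ε ≤ ‖1 / √(n : ℝ) * (s n ω -
      ∑ i ∈ Finset.range (count (fun j => T j ω) n), R (Y i ω))‖ := by
    rw [← sub_zero (1 / √(n : ℝ) * _)]
    exact hmem
  rw [norm_mul, Real.norm_eq_abs, Real.norm_eq_abs, abs_of_pos (one_div_pos.2 hn'),
    one_div_mul_eq_div, le_div_iff₀ hn', hj, Finset.sum_range_succ] at hmem'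
  have htri : |s n ω - (∑ i ∈ Finset.range j, R (Y i ω) + R (Y j ω))| ≤
      |s n ω - s (T j ω) ω| + |s (T 0 ω) ω| + |R (Y j ω)| := by
    have : s n ω - (∑ i ∈ Finset.range j, R (Y i ω) + R (Y j ω)) =
        (s n ω - s (T j ω) ω) + s (T 0 ω) ω - R (Y j ω) := by rw [hsTj]; ring
    rw [this]
    exact (abs_sub _ _).trans (add_le_add_left (abs_add_le _ _) _)
  linarith

/-- The renewal-reward central limit theorem. -/
theorem tendstoInDistribution [IsProbabilityMeasure ν] (h : Renewal P ν len T Y)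
    (hlen : Integrable (fun c => (len c : ℝ)) ν) {R : C → ℝ} (hR : MemLp R 2 ν)
    (hR0 : ∫ c, R c ∂ν = 0) {s : ℕ → Ω → ℝ} (hs : ∀ n, Measurable (s n))
    (hsum : ∀ᵐ ω ∂P, ∀ j, s (T (j + 1) ω) ω = s (T j ω) ω + R (Y j ω)) (B : C → ℝ)
    (hB : ∀ᵐ ω ∂P, ∀ j n, T j ω ≤ n → n < T (j + 1) ω → |s n ω - s (T j ω) ω| ≤ B (Y j ω)) :
    TendstoInDistribution (fun (n : ℕ) ω => (1 / √n) * s n ω) atTop (id : ℝ → ℝ) (fun _ => P)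
      (gaussianReal 0 ((∫ c, R c ^ 2 ∂ν) / ∫ c, (len c : ℝ) ∂ν).toNNReal) := by
  refine tendstoInDistribution_of_tendstoInMeasure_sub _ _
    (tendstoInDistribution_of_tendstoInMeasure_sub (fun (n : ℕ) ω => (1 / √n) *
      ∑ j ∈ Finset.range (count (fun j => T j ω) n), R (Y j ω)) _
      (h.tendstoInDistribution_sum_floor hlen hR hR0) ?_ fun n =>
      ((h.measurable_sum_count R n).const_mul _).aemeasurable) ?_ fun n =>
      ((hs n).const_mul _).aemeasurable
  · refine (h.tendstoInMeasure_sum_count_sub hlen hR hR0).congr_left fun n =>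
      Eventually.of_forall fun ω => mul_sub _ _ _
  · refine (h.tendstoInMeasure_sub_sum_count hlen R hs hsum B hB).congr_left fun n =>
      Eventually.of_forall fun ω => mul_sub _ _ _

end Renewal

/-! ### Decomposition of the walk into cycles. -/

section Cycles

/-- The first visit of a path to `(0, 1)`. -/
noncomputable def hitTime (x : ℕ → State) : ℕ := sInf {t | x t = (0, 1)}

open Classical in
/-- The cycle followed by a path after time `t`. -/
noncomputable def cycleAt (x : ℕ → State) (t : ℕ) : ℕ × ℕ :=
  if h : ∃ c, Follows x t (cycle c) then h.choose else 0

/-- The successive visits of a path to `(0, 1)`. -/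
noncomputable def visitTime (x : ℕ → State) : ℕ → ℕ
  | 0 => hitTime x
  | j + 1 => visitTime x j + (cycle (cycleAt x (visitTime x j))).length

/-- The cycle which follows the `j`-th visit to `(0, 1)`. -/
noncomputable def visitCycle (x : ℕ → State) (j : ℕ) : ℕ × ℕ := cycleAt x (visitTime x j)

/-- The concatenation of the cycles `c 0, …, c (m - 1)`. -/
def cycles (c : ℕ → ℕ × ℕ) : ℕ → List State
  | 0 => []
  | m + 1 => cycles c m ++ cycle (c m)

/-- The path visits `(0, 1)`, and every such visit is followed by a cycle. -/
def IsRegenerative (x : ℕ → State) : Prop :=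
  (∃ t, x t = (0, 1)) ∧ ∀ t, x t = (0, 1) → ∃ c, Follows x t (cycle c)

lemma endpoint_cycles (c : ℕ → ℕ × ℕ) (m : ℕ) : endpoint (0, 1) (cycles c m) = (0, 1) := by
  cases m with
  | zero => rfl
  | succ m => rw [cycles, endpoint_append, endpoint_cycle]

lemma wordProb_cycles (U : ℤ → ℝ) (c : ℕ → ℕ × ℕ) (m : ℕ) :
    wordProb (kernel U) (0, 1) (cycles c m) =
      ∏ i ∈ Finset.range m, wordProb (kernel U) (0, 1) (cycle (c i)) := by
  induction m with
  | zero => rfl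
  | succ m ih => rw [cycles, wordProb_append, endpoint_cycles, Finset.prod_range_succ, ih]

lemma Follows.cycleAt_eq {x : ℕ → State} {t : ℕ} {c : ℕ × ℕ} (h : Follows x t (cycle c)) :
    cycleAt x t = c := by
  have hex : ∃ c, Follows x t (cycle c) := ⟨c, h⟩
  rw [cycleAt, dif_pos hex]
  exact hex.choose_spec.cycle_unique h

variable {x : ℕ → State}

lemma IsRegenerative.follows_cycleAt (hx : IsRegenerative x) {t : ℕ} (ht : x t = (0, 1)) :
    Follows x t (cycle (cycleAt x t)) := by
  obtain ⟨c, hc⟩ := hx.2 t ht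
  rwa [hc.cycleAt_eq]

lemma IsRegenerative.apply_visitTime (hx : IsRegenerative x) (j : ℕ) :
    x (visitTime x j) = (0, 1) := by
  induction j with
  | zero => exact Nat.sInf_mem hx.1
  | succ j ih => exact (hx.follows_cycleAt ih).endpoint.trans (endpoint_cycle _ _)

lemma IsRegenerative.follows_visitCycle (hx : IsRegenerative x) (j : ℕ) :
    Follows x (visitTime x j) (cycle (visitCycle x j)) :=
  hx.follows_cycleAt (hx.apply_visitTime j)

lemma visitTime_eq_of_visitCycle {c : ℕ → ℕ × ℕ} {m : ℕ} (h : ∀ i < m, visitCycle x i = c i) :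
    visitTime x m = hitTime x + (cycles c m).length := by
  induction m with
  | zero => rfl
  | succ m ih =>
    rw [visitTime, ih fun i hi => h i (hi.trans m.lt_succ_self), cycles, List.length_append,
      ← h m m.lt_succ_self, visitCycle, ih fun i hi => h i (hi.trans m.lt_succ_self), add_assoc]

/-- Distinct cycles exclude each other, so the decomposition is unique. An event about marks thereby
becomes one about a word, to which the Markov property applies. -/
lemma IsRegenerative.follows_cycles_iff (hx : IsRegenerative x) (c : ℕ → ℕ × ℕ) (m : ℕ) :
    Follows x (hitTime x) (cycles c m) ↔ ∀ i < m, visitCycle x i = c i := by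
  induction m with
  | zero => simp [cycles]
  | succ m ih =>
    rw [cycles, follows_append, ih, Nat.forall_lt_succ_right]
    refine and_congr_right fun h => ?_
    rw [← visitTime_eq_of_visitCycle h]
    exact ⟨fun hf => hf.cycleAt_eq, fun hf => hf ▸ hx.follows_visitCycle m⟩

lemma IsRegenerative.hitTime_eq_iff (hx : IsRegenerative x) (t : ℕ) :
    hitTime x = t ↔ (∀ k < t, x k ≠ (0, 1)) ∧ x t = (0, 1) := by
  constructor
  · rintro rfl
    exact ⟨fun k hk => Nat.notMem_of_lt_sInf (s := {t | x t = (0, 1)}) hk, Nat.sInf_mem hx.1⟩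
  · rintro ⟨h1, h2⟩
    refine le_antisymm (Nat.sInf_le h2) (not_lt.1 fun hlt => h1 _ hlt (Nat.sInf_mem hx.1))

/-- The sum of `f` over a cycle of a path, in terms of partial sums. -/
lemma IsRegenerative.sum_visitTime_succ (hx : IsRegenerative x) (f : State → ℝ) (j : ℕ) :
    ∑ k ∈ Finset.range (visitTime x (j + 1)), f (x k) =
      ∑ k ∈ Finset.range (visitTime x j), f (x k) + cycleSum f (visitCycle x j) := by
  have hsum := (hx.follows_visitCycle j).sum_eq f
  have hlen : visitTime x (j + 1) = visitTime x j + (cycle (visitCycle x j)).length := rfl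
  -- A cycle word omits its starting state and contains its last one, while `Finset.range` does the
  -- opposite; both states are `(0, 1)`, so the shift by one changes nothing.
  have h1 : f (x (visitTime x (j + 1))) = f (x (visitTime x j)) := by
    rw [hx.apply_visitTime, hx.apply_visitTime]
  have h2 := Finset.sum_range_succ (fun k => f (x k)) (visitTime x (j + 1))
  have h3 := Finset.sum_range_succ (fun k => f (x k)) (visitTime x j)
  have h4 : ∑ k ∈ Finset.range (visitTime x (j + 1) + 1), f (x k) =
      ∑ k ∈ Finset.range (visitTime x j + 1), f (x k) + cycleSum f (visitCycle x j) := by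
    rw [← sum_cycle, ← hsum, hlen, add_right_comm, Finset.sum_range_add]
  linarith

/-- Within a cycle, the partial sums are controlled by the sum of `|f|` over the cycle. -/
lemma IsRegenerative.abs_sum_sub_le (hx : IsRegenerative x) (f : State → ℝ) {j n : ℕ}
    (h1 : visitTime x j ≤ n) (h2 : n < visitTime x (j + 1)) :
    |∑ k ∈ Finset.range n, f (x k) - ∑ k ∈ Finset.range (visitTime x j), f (x k)| ≤
      cycleSum (fun z => |f z|) (visitCycle x j) := by
  have h := hx.sum_visitTime_succ (fun z => |f z|) j
  rw [← Finset.sum_range_add_sum_Ico _ h1, add_sub_cancel_left]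
  rw [← Finset.sum_range_add_sum_Ico _ (h1.trans h2.le)] at h
  refine (Finset.abs_sum_le_sum_abs _ _).trans ?_
  rw [← add_left_cancel h]
  exact Finset.sum_le_sum_of_subset_of_nonneg (Finset.Ico_subset_Ico_right h2.le)
    fun _ _ _ => abs_nonneg _

variable {Ω : Type*} [MeasurableSpace Ω] {X : ℕ → Ω → State}

lemma measurable_hitTime (hX : ∀ n, Measurable (X n)) : Measurable fun ω => hitTime (X · ω) := by
  refine measurable_of_Iio fun t => ?_
  rcases Nat.eq_zero_or_pos t with rfl | ht
  · simp
  -- The intersection collects the paths that never visit `(0, 1)`, for which `sInf ∅ = 0 < t`.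
  have : (fun ω => hitTime (X · ω)) ⁻¹' Set.Iio t =
      (⋃ k ∈ Set.Iio t, X k ⁻¹' {(0, 1)}) ∪ ⋂ k, (X k ⁻¹' {(0, 1)})ᶜ := by
    ext ω
    simp only [Set.mem_preimage, Set.mem_Iio, Set.mem_union, Set.mem_iUnion, Set.mem_iInter,
      Set.mem_compl_iff, Set.mem_singleton_iff, exists_prop]
    constructor
    · intro h
      by_cases hex : ∃ k, X k ω = (0, 1)
      · exact Or.inl ⟨_, h, Nat.sInf_mem (s := {t | X t ω = (0, 1)}) hex⟩
      · exact Or.inr (not_exists.1 hex)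
    · rintro (⟨k, hk, hk'⟩ | h)
      · exact (Nat.sInf_le (s := {t | X t ω = (0, 1)}) hk').trans_lt hk
      · have : {t | X t ω = (0, 1)} = ∅ := Set.eq_empty_of_forall_notMem h
        rw [hitTime, this, Nat.sInf_empty]
        exact ht
  rw [this]
  exact (MeasurableSet.biUnion (Set.to_countable _) fun k _ =>
    hX k (measurableSet_singleton _)).union
    (MeasurableSet.iInter fun k => (hX k (measurableSet_singleton _)).compl)

variable {P : Measure Ω} {U : ℤ → ℝ}

lemma measurable_cycleAt (hX : IsMarkovChain P (kernel U) X) (t : ℕ) :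
    Measurable fun ω => cycleAt (X · ω) t := by
  classical
  have hm : ∀ c, MeasurableSet {ω | Follows (X · ω) t (cycle c)} := fun c =>
    hX.measurableSet_follows t _
  refine measurable_to_countable' fun c => ?_
  -- The second set accounts for the default value `0` on paths that follow no cycle after `t`.
  have : (fun ω => cycleAt (X · ω) t) ⁻¹' {c} = {ω | Follows (X · ω) t (cycle c)} ∪
      ({_ω | c = 0} ∩ ⋂ c, {ω | Follows (X · ω) t (cycle c)}ᶜ) := by
    ext ω
    simp only [Set.mem_preimage, Set.mem_singleton_iff, Set.mem_union, Set.mem_inter_iff,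
      Set.mem_iInter, Set.mem_compl_iff, Set.mem_ofPred_eq]
    by_cases hex : ∃ c, Follows (X · ω) t (cycle c)
    · obtain ⟨c', hc'⟩ := hex
      rw [hc'.cycleAt_eq]
      constructor
      · rintro rfl
        exact Or.inl hc'
      · rintro (h | h)
        · exact hc'.cycle_unique h
        · exact absurd hc' (h.2 c')
    · have hex' := not_exists.1 hex
      rw [cycleAt, dif_neg hex]
      exact ⟨fun h => Or.inr ⟨h.symm, hex'⟩, fun h => (h.resolve_left (hex' c)).1.symm⟩
  rw [this]
  exact (hm c).union ((MeasurableSet.const _).inter (MeasurableSet.iInter fun c => (hm c).compl))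

lemma measurable_visitTime (hX : IsMarkovChain P (kernel U) X) (j : ℕ) :
    Measurable (fun ω => visitTime (X · ω) j) ∧ Measurable fun ω => visitCycle (X · ω) j := by
  have hstep : ∀ j, Measurable (fun ω => visitTime (X · ω) j) →
      Measurable fun ω => visitCycle (X · ω) j := fun j hj => by
    have h1 : Measurable fun p : ℕ × Ω => cycleAt (X · p.2) p.1 :=
      measurable_from_prod_countable_right fun t => measurable_cycleAt hX t
    exact h1.comp (hj.prodMk measurable_id)
  have hT : ∀ j, Measurable fun ω => visitTime (X · ω) j := fun j => by
    induction j with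
    | zero => exact measurable_hitTime hX.measurable
    | succ j ih =>
      exact ih.add ((measurable_of_countable fun c => (cycle c).length).comp (hstep j ih))
  exact ⟨hT j, hstep j (hT j)⟩

/-- The law of the number of outward steps in an excursion with velocity `v` from the origin. -/
noncomputable def excursionMeasure (U : ℤ → ℝ) (v : ℤˣ) : Measure ℕ :=
  Measure.count.withDensity fun n => wordProb (kernel U) (0, v) (excursion v 0 n)

/-- The law of a cycle. -/
noncomputable def cycleMeasure (U : ℤ → ℝ) : Measure (ℕ × ℕ) :=
  (excursionMeasure U 1).prod (excursionMeasure U (-1))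

lemma excursionMeasure_singleton (U : ℤ → ℝ) (v : ℤˣ) (n : ℕ) :
    excursionMeasure U v {n} = wordProb (kernel U) (0, v) (excursion v 0 n) := by
  rw [excursionMeasure, withDensity_apply _ (measurableSet_singleton n)]
  simp

lemma isProbabilityMeasure_excursionMeasure (hZ : Summable fun x : ℤ => Real.exp (-U x))
    (hdec : AntitoneOn U (Set.Iic 0)) (hinc : MonotoneOn U (Set.Ici 0)) (v : ℤˣ) :
    IsProbabilityMeasure (excursionMeasure U v) := by
  constructor
  have h := tsum_wordProb_excursion hZ hdec hinc v 0
  simp only [Nat.cast_zero, zero_mul] at h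
  rw [excursionMeasure, withDensity_apply _ MeasurableSet.univ, Measure.restrict_univ,
    lintegral_count, h]

variable [IsProbabilityMeasure P]

/-- The cycles of the Zig-Zag walk form a delayed renewal process. -/
lemma renewal (hZ : Summable fun x : ℤ => Real.exp (-U x))
    (hdec : AntitoneOn U (Set.Iic 0)) (hinc : MonotoneOn U (Set.Ici 0))
    (hX : IsMarkovChain P (kernel U) X) :
    Renewal P (cycleMeasure U) (fun c => (cycle c).length) (fun j ω => visitTime (X · ω) j)
      fun j ω => visitCycle (X · ω) j where
  measurable_zero := (measurable_visitTime hX 0).1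
  measurable_mark j := (measurable_visitTime hX j).2
  len_pos := length_cycle_pos
  succ _ _ := rfl
  law m t c := by
    have := isProbabilityMeasure_excursionMeasure hZ hdec hinc (-1)
    have hν : ∀ c, cycleMeasure U {c} = wordProb (kernel U) (0, 1) (cycle c) := fun c => by
      rw [wordProb_cycle, ← excursionMeasure_singleton, ← excursionMeasure_singleton, cycleMeasure,
        ← Measure.prod_prod, Set.singleton_prod_singleton]
    -- Almost surely, the first visit occurs at `t` exactly on `A ∩ {X t = (0, 1)}`; as `A` concerns
    -- the past only, the Markov property at the fixed time `t` suffices.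
    let A : Set Ω := {ω | ∀ k < t, X k ω ≠ (0, 1)}
    have hA : DependsUpTo X t A := fun ω ω' h hω k hk => by
      rw [← h k hk.le]
      exact hω k hk
    have hreg := ae_exists_cycle hZ hdec hinc hX
    have e1 : P {ω | visitTime (X · ω) 0 = t} = P (A ∩ {ω | X t ω = (0, 1)}) := by
      refine measure_congr ?_
      filter_upwards [hreg] with ω hω
      exact propext (IsRegenerative.hitTime_eq_iff hω t)
    have e2 : P {ω | visitTime (X · ω) 0 = t ∧ ∀ i < m, visitCycle (X · ω) i = c i} =
        P (A ∩ {ω | X t ω = (0, 1)} ∩ {ω | Follows (X · ω) t (cycles c m)}) := by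
      refine measure_congr ?_
      filter_upwards [hreg] with ω hω
      refine propext (Iff.trans ?_ (and_congr_left' (IsRegenerative.hitTime_eq_iff hω t)))
      refine and_congr_right fun ht => ?_
      rw [← show hitTime (X · ω) = t from ht]
      exact (IsRegenerative.follows_cycles_iff hω c m).symm
    simp_rw [hν]
    rw [e1, e2, hX.measure_inter_follows hA, wordProb_cycles]

end Cycles

/-! ### Integrals against discrete densities and splitting of sums over `ℤ`. -/

section Discrete

variable {α : Type*} [Countable α] [MeasurableSpace α] [MeasurableSingletonClass α] {w : α → ℝ}

lemma integrable_count_withDensity_iff (hw : ∀ a, 0 ≤ w a) {f : α → ℝ} :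
    Integrable f (Measure.count.withDensity fun a => ENNReal.ofReal (w a)) ↔
      Summable fun a => f a * w a := by
  rw [integrable_withDensity_iff_integrable_smul' (measurable_of_countable _)
    (Eventually.of_forall fun _ => ENNReal.ofReal_lt_top), integrable_count_iff]
  refine summable_norm_iff.trans (summable_congr fun a => ?_)
  rw [ENNReal.toReal_ofReal (hw a), smul_eq_mul, mul_comm]

lemma integral_count_withDensity (hw : ∀ a, 0 ≤ w a) {f : α → ℝ}
    (hf : Summable fun a => f a * w a) :
    ∫ a, f a ∂(Measure.count.withDensity fun a => ENNReal.ofReal (w a)) = ∑' a, f a * w a := by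
  rw [integral_countable ((integrable_count_withDensity_iff hw).2 hf)]
  refine tsum_congr fun a => ?_
  rw [measureReal_def, withDensity_apply _ (measurableSet_singleton a)]
  simp [ENNReal.toReal_ofReal (hw a), mul_comm]

end Discrete

section Rays

lemma cast_succ_mul_one (k : ℕ) : (((k + 1 : ℕ) : ℤ) * ((1 : ℤˣ) : ℤ)) = k + 1 := by simp

lemma cast_succ_mul_neg_one (k : ℕ) : (((k + 1 : ℕ) : ℤ) * ((-1 : ℤˣ) : ℤ)) = -(k + 1) := by
  simp

lemma summable_ray_succ {h : ℤ → ℝ} (hh : Summable h) (v : ℤˣ) :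
    Summable fun k : ℕ => h ((k + 1 : ℕ) * v) :=
  hh.comp_injective (i := fun k : ℕ => ((k + 1 : ℕ) * v : ℤ))
    fun _ _ hab => Nat.succ_injective (ray_injective v hab)

lemma tsum_int_eq_rays {h : ℤ → ℝ} (hh : Summable h) :
    ∑' x, h x = h 0 + ∑' k : ℕ, h ((k + 1 : ℕ) * (1 : ℤˣ)) +
      ∑' k : ℕ, h ((k + 1 : ℕ) * (-1 : ℤˣ)) := by
  have h2 := (summable_ray_succ hh (-1)).hasSum
  have h1 : Summable fun k : ℕ => h k := hh.comp_injective Nat.cast_injective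
  have h1' := h1.hasSum
  rw [h1.tsum_eq_zero_add] at h1'
  simp only [cast_succ_mul_neg_one] at h2 ⊢
  simp only [cast_succ_mul_one]
  exact_mod_cast (h1'.of_nat_of_neg_add_one h2).tsum_eq

end Rays

/-! ### Moments of excursion functionals and the origin of `F`. -/

section Excursions

variable {U : ℤ → ℝ}

/-- The walk makes more than `k` outward steps exactly when it reaches `(k + 1) v`; in the proof the
complementary probabilities telescope. -/
lemma measureReal_excursionMeasure_Ioi (hZ : Summable fun x : ℤ => Real.exp (-U x))
    (hdec : AntitoneOn U (Set.Iic 0)) (hinc : MonotoneOn U (Set.Ici 0)) (v : ℤˣ) (k : ℕ) :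
    (excursionMeasure U v).real (Set.Ioi k) = gibbs U ((k + 1 : ℕ) * v) / gibbs U 0 := by
  have := isProbabilityMeasure_excursionMeasure hZ hdec hinc v
  have hπ := gibbs_pos hZ 0
  have hs : ∀ n, (excursionMeasure U v).real {n} =
      gibbs U (n * v) / gibbs U 0 - gibbs U ((n + 1 : ℕ) * v) / gibbs U 0 := fun n => by
    have h := wordProb_excursion hZ hdec hinc v 0 n
    simp only [Nat.cast_zero, zero_mul, zero_add] at h
    rw [measureReal_def, excursionMeasure_singleton, h, ENNReal.toReal_ofReal, sub_div]
    exact div_nonneg (sub_nonneg.2 (gibbs_antitone_ray hZ hdec hinc v n.le_succ)) hπ.le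
  have hcompl : Set.Ioi k = ((Finset.range (k + 1) : Finset ℕ) : Set ℕ)ᶜ := by
    ext n
    simp
  rw [hcompl, probReal_compl_eq_one_sub (Finset.measurableSet _), ← sum_measureReal_singleton]
  simp_rw [hs]
  rw [Finset.sum_range_sub']
  simp [hπ.ne']

/-- The mean of an additive functional of the length of an excursion. -/
lemma integrable_and_integral_excursion (hZ : Summable fun x : ℤ => Real.exp (-U x))
    (hdec : AntitoneOn U (Set.Iic 0)) (hinc : MonotoneOn U (Set.Ici 0)) (v : ℤˣ) {u : ℕ → ℝ}
    (hu : Summable fun k => u k * gibbs U ((k + 1 : ℕ) * v)) :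
    Integrable (fun n => ∑ k ∈ Finset.range n, u k) (excursionMeasure U v) ∧
      ∫ n, ∑ k ∈ Finset.range n, u k ∂(excursionMeasure U v) =
        (∑' k, u k * gibbs U ((k + 1 : ℕ) * v)) / gibbs U 0 := by
  have := isProbabilityMeasure_excursionMeasure hZ hdec hinc v
  have hπ := gibbs_pos hZ 0
  set ρ := excursionMeasure U v
  -- The sum over `k < n` is the series of `u k * 1_{n > k}`, so exchanging sum and integral reduces
  -- the mean to tail probabilities.
  let A : ℕ → ℕ → ℝ := fun k => (Set.Ioi k).indicator fun _ => u k
  have hA : ∀ n, HasSum (fun k => A k n) (∑ k ∈ Finset.range n, u k) := fun n => by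
    have h : HasSum (fun k => A k n) (∑ k ∈ Finset.range n, A k n) :=
      hasSum_sum_of_ne_finset_zero fun k hk => Set.indicator_of_notMem (by simpa using hk) _
    convert h using 1
    refine Finset.sum_congr rfl fun k hk => ?_
    rw [show A k n = u k from Set.indicator_of_mem (by simpa using hk) _]
  have hAint : ∀ k, Integrable (A k) ρ := fun k =>
    (integrable_const _).indicator measurableSet_Ioi
  have hnorm : ∀ k, ∫ n, ‖A k n‖ ∂ρ = |u k * gibbs U ((k + 1 : ℕ) * v)| / gibbs U 0 := fun k => by
    have : (fun n => ‖A k n‖) = (Set.Ioi k).indicator fun _ => |u k| := by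
      funext n
      simp only [A, norm_indicator_eq_indicator_norm, Real.norm_eq_abs]
    rw [this, integral_indicator_const _ measurableSet_Ioi,
      measureReal_excursionMeasure_Ioi hZ hdec hinc, abs_mul, abs_of_pos (gibbs_pos hZ _),
      smul_eq_mul]
    ring
  have hsum : Summable fun k => ∫ n, ‖A k n‖ ∂ρ := by
    simp_rw [hnorm]
    exact hu.abs.div_const _
  have hval := hasSum_integral_of_summable_integral_norm hAint hsum
  have htsum : ∀ n, ∑' k, A k n = ∑ k ∈ Finset.range n, u k := fun n => (hA n).tsum_eq
  simp_rw [htsum] at hval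
  constructor
  · refine ⟨(measurable_of_countable _).aestronglyMeasurable, ?_⟩
    have hle : ∀ n, ‖∑ k ∈ Finset.range n, u k‖ₑ ≤ ∑' k, ‖A k n‖ₑ := fun n => by
      rw [← htsum]
      exact enorm_tsum_le_tsum_enorm
    refine lt_of_le_of_lt (lintegral_mono hle) ?_
    rw [lintegral_tsum fun k => (measurable_of_countable _).aemeasurable]
    have : ∀ k, ∫⁻ n, ‖A k n‖ₑ ∂ρ = ENNReal.ofReal (∫ n, ‖A k n‖ ∂ρ) := fun k =>
      (ofReal_integral_norm_eq_lintegral_enorm (hAint k)).symm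
    simp_rw [this]
    exact hsum.tsum_ofReal_lt_top
  · rw [← hval.tsum_eq, ← tsum_div_const]
    refine tsum_congr fun k => ?_
    rw [integral_indicator_const _ measurableSet_Ioi,
      measureReal_excursionMeasure_Ioi hZ hdec hinc, smul_eq_mul]
    ring

/-- Increment of the square: `(S + u)² - S² = 2 u (S + u / 2)`. With `u = g` along a half-line, the
bracket is `F`. -/
lemma sum_range_sq (u : ℕ → ℝ) (n : ℕ) :
    (∑ k ∈ Finset.range n, u k) ^ 2 =
      ∑ k ∈ Finset.range n, 2 * (u k * (∑ i ∈ Finset.range k, u i + u k / 2)) := by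
  induction n with
  | zero => simp
  | succ n ih => rw [Finset.sum_range_succ, Finset.sum_range_succ _ n, ← ih]; ring

lemma F_ray (f : State → ℝ) (v : ℤˣ) (k : ℕ) :
    F f ((k + 1 : ℕ) * v) =
      ∑ i ∈ Finset.range k, g f ((i + 1 : ℕ) * v) + g f ((k + 1 : ℕ) * v) / 2 := by
  rcases Int.units_eq_one_or v with rfl | rfl
  · simp only [cast_succ_mul_one, F]
    rw [if_pos (by omega), if_neg (by omega), add_zero, add_comm, one_div_mul_eq_div]
    congr 1
    refine (Finset.sum_bij (fun (i : ℕ) _ => (i : ℤ) + 1) ?_ ?_ ?_ ?_).symm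
    · intro i hi
      rw [Finset.mem_range] at hi
      rw [Finset.mem_Icc]
      omega
    · intro i _ j _ h
      omega
    · intro x hx
      rw [Finset.mem_Icc] at hx
      exact ⟨(x - 1).toNat, Finset.mem_range.2 (by omega), by omega⟩
    · intro i _
      rfl
  · simp only [cast_succ_mul_neg_one, F]
    rw [if_neg (by omega), if_pos (by omega), add_zero, add_comm, one_div_mul_eq_div]
    congr 1
    refine (Finset.sum_bij (fun (i : ℕ) _ => -((i : ℤ) + 1)) ?_ ?_ ?_ ?_).symm
    · intro i hi
      rw [Finset.mem_range] at hi
      rw [Finset.mem_Icc]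
      omega
    · intro i _ j _ h
      omega
    · intro x hx
      rw [Finset.mem_Icc] at hx
      exact ⟨(-x - 1).toNat, Finset.mem_range.2 (by omega), by omega⟩
    · intro i _
      rfl

end Excursions

/-! ### First and second moments of the cycle sums. -/

section Integrals

variable {U : ℤ → ℝ} {f : State → ℝ}

lemma summable_g (hZ : Summable fun x : ℤ => Real.exp (-U x))
    (hf : Integrable f (phaseMeasure U)) : Summable fun x => g f x * gibbs U x := by
  have h := (integrable_count_withDensity_iff
    (fun z : State => div_nonneg (gibbs_pos hZ z.1).le zero_le_two)).1 hf
  have h1 := h.comp_injective (i := fun x : ℤ => ((x, 1) : State)) fun a b => congrArg Prod.fst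
  have h2 := h.comp_injective (i := fun x : ℤ => ((x, -1) : State)) fun a b => congrArg Prod.fst
  refine ((h1.add h2).mul_left 2).congr fun x => ?_
  simp only [Function.comp_apply, g]
  ring

lemma integral_phaseMeasure (hZ : Summable fun x : ℤ => Real.exp (-U x))
    (hf : Integrable f (phaseMeasure U)) :
    ∫ z, f z ∂(phaseMeasure U) = (∑' x, g f x * gibbs U x) / 2 := by
  have hw := fun z : State => div_nonneg (gibbs_pos hZ z.1).le zero_le_two
  have h := (integrable_count_withDensity_iff hw).1 hf
  rw [phaseMeasure, integral_count_withDensity hw h, h.tsum_prod, ← tsum_div_const]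
  refine tsum_congr fun x => ?_
  rw [tsum_fintype, UnitsInt.univ, Finset.sum_pair (by decide), g]
  ring

lemma integral_gibbsMeasure (hZ : Summable fun x : ℤ => Real.exp (-U x)) {h : ℤ → ℝ}
    (hh : Summable fun x => h x * gibbs U x) :
    ∫ x, h x ∂(gibbsMeasure U) = h 0 * gibbs U 0 +
      ∑' k : ℕ, h ((k + 1 : ℕ) * (1 : ℤˣ)) * gibbs U ((k + 1 : ℕ) * (1 : ℤˣ)) +
      ∑' k : ℕ, h ((k + 1 : ℕ) * (-1 : ℤˣ)) * gibbs U ((k + 1 : ℕ) * (-1 : ℤˣ)) := by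
  rw [gibbsMeasure, integral_count_withDensity (fun x => (gibbs_pos hZ x).le) hh,
    tsum_int_eq_rays hh]

lemma setIntegral_gibbsMeasure (hZ : Summable fun x : ℤ => Real.exp (-U x)) {h : ℤ → ℝ}
    (hh : Summable fun x => h x * gibbs U x) :
    ∫ x in Set.Ici (1 : ℤ), h x ∂(gibbsMeasure U) =
      ∑' k : ℕ, h ((k + 1 : ℕ) * (1 : ℤˣ)) * gibbs U ((k + 1 : ℕ) * (1 : ℤˣ)) ∧
    ∫ x in Set.Iic (-1 : ℤ), h x ∂(gibbsMeasure U) =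
      ∑' k : ℕ, h ((k + 1 : ℕ) * (-1 : ℤˣ)) * gibbs U ((k + 1 : ℕ) * (-1 : ℤˣ)) := by
  have hind : ∀ s : Set ℤ, Summable fun x => s.indicator h x * gibbs U x := fun s => by
    refine (hh.indicator s).congr fun x => ?_
    by_cases hx : x ∈ s <;> simp [hx]
  constructor
  · rw [← integral_indicator measurableSet_Ici, integral_gibbsMeasure hZ (hind _)]
    have h1 : ∀ k : ℕ, ((k + 1 : ℕ) * (1 : ℤˣ) : ℤ) ∈ Set.Ici (1 : ℤ) := fun k => by
      rw [cast_succ_mul_one, Set.mem_Ici]; omega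
    have h2 : ∀ k : ℕ, ((k + 1 : ℕ) * (-1 : ℤˣ) : ℤ) ∉ Set.Ici (1 : ℤ) := fun k => by
      rw [cast_succ_mul_neg_one, Set.mem_Ici]; omega
    simp_rw [Set.indicator_of_mem (h1 _), Set.indicator_of_notMem (h2 _)]
    simp
  · rw [← integral_indicator measurableSet_Iic, integral_gibbsMeasure hZ (hind _)]
    have h1 : ∀ k : ℕ, ((k + 1 : ℕ) * (1 : ℤˣ) : ℤ) ∉ Set.Iic (-1 : ℤ) := fun k => by
      rw [cast_succ_mul_one, Set.mem_Iic]; omega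
    have h2 : ∀ k : ℕ, ((k + 1 : ℕ) * (-1 : ℤˣ) : ℤ) ∈ Set.Iic (-1 : ℤ) := fun k => by
      rw [cast_succ_mul_neg_one, Set.mem_Iic]; omega
    simp_rw [Set.indicator_of_notMem (h1 _), Set.indicator_of_mem (h2 _)]
    simp

/-- The sum of `g` over an excursion, the origin excluded. -/
def excursionSum (f : State → ℝ) (v : ℤˣ) (n : ℕ) : ℝ :=
  ∑ i ∈ Finset.range n, g f ((i + 1 : ℕ) * v)

lemma cycleSum_eq (f : State → ℝ) (c : ℕ × ℕ) :
    cycleSum f c = g f 0 + excursionSum f 1 c.1 + excursionSum f (-1) c.2 := by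
  simp [cycleSum, excursionSum]

lemma integrable_and_integral_excursionSum (hZ : Summable fun x : ℤ => Real.exp (-U x))
    (hdec : AntitoneOn U (Set.Iic 0)) (hinc : MonotoneOn U (Set.Ici 0))
    (hf : Integrable f (phaseMeasure U)) (v : ℤˣ) :
    Integrable (excursionSum f v) (excursionMeasure U v) ∧
      ∫ n, excursionSum f v n ∂(excursionMeasure U v) =
        (∑' k : ℕ, g f ((k + 1 : ℕ) * v) * gibbs U ((k + 1 : ℕ) * v)) / gibbs U 0 :=
  integrable_and_integral_excursion hZ hdec hinc v (summable_ray_succ (summable_g hZ hf) v)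

/-- The mean of the sum over a cycle is `2 μ(f) / π(0)`. -/
lemma integrable_and_integral_cycleSum (hZ : Summable fun x : ℤ => Real.exp (-U x))
    (hdec : AntitoneOn U (Set.Iic 0)) (hinc : MonotoneOn U (Set.Ici 0))
    (hf : Integrable f (phaseMeasure U)) :
    Integrable (cycleSum f) (cycleMeasure U) ∧
      ∫ c, cycleSum f c ∂(cycleMeasure U) = 2 / gibbs U 0 * ∫ z, f z ∂(phaseMeasure U) := by
  have := isProbabilityMeasure_excursionMeasure hZ hdec hinc 1
  have := isProbabilityMeasure_excursionMeasure hZ hdec hinc (-1)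
  have hπ := gibbs_pos hZ 0
  obtain ⟨h1, h1'⟩ := integrable_and_integral_excursionSum hZ hdec hinc hf 1
  obtain ⟨h2, h2'⟩ := integrable_and_integral_excursionSum hZ hdec hinc hf (-1)
  have i1 : Integrable (fun c : ℕ × ℕ => excursionSum f 1 c.1) (cycleMeasure U) := h1.comp_fst _
  have i2 : Integrable (fun c : ℕ × ℕ => excursionSum f (-1) c.2) (cycleMeasure U) := h2.comp_snd _
  have i0 : Integrable (fun _ : ℕ × ℕ => g f 0) (cycleMeasure U) := by
    rw [cycleMeasure]; exact integrable_const _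
  have i01 : Integrable (fun c : ℕ × ℕ => g f 0 + excursionSum f 1 c.1) (cycleMeasure U) :=
    i0.add i1
  have e : cycleSum f = fun c => g f 0 + excursionSum f 1 c.1 + excursionSum f (-1) c.2 :=
    funext (cycleSum_eq f)
  rw [e]
  refine ⟨i01.add i2, ?_⟩
  rw [integral_add i01 i2, integral_add i0 i1, integral_phaseMeasure hZ hf,
    tsum_int_eq_rays (summable_g hZ hf), cycleMeasure, integral_fun_fst, integral_fun_snd,
    h1', h2']
  simp only [integral_const, probReal_univ, smul_eq_mul, one_mul]
  field_simp

/-- The second moment of the sum over an excursion. -/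
lemma memLp_and_integral_excursionSum_sq (hZ : Summable fun x : ℤ => Real.exp (-U x))
    (hdec : AntitoneOn U (Set.Iic 0)) (hinc : MonotoneOn U (Set.Ici 0))
    (hgF : Summable fun x => g f x * F f x * gibbs U x) (v : ℤˣ) :
    MemLp (excursionSum f v) 2 (excursionMeasure U v) ∧
      ∫ n, excursionSum f v n ^ 2 ∂(excursionMeasure U v) =
        2 * (∑' k : ℕ, g f ((k + 1 : ℕ) * v) * F f ((k + 1 : ℕ) * v) *
          gibbs U ((k + 1 : ℕ) * v)) / gibbs U 0 := by
  have e : ∀ n, excursionSum f v n ^ 2 =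
      ∑ k ∈ Finset.range n, 2 * (g f ((k + 1 : ℕ) * v) * F f ((k + 1 : ℕ) * v)) := fun n => by
    simp_rw [F_ray]
    exact sum_range_sq _ n
  have hs := (summable_ray_succ hgF v).mul_left 2
  obtain ⟨h1, h2⟩ := integrable_and_integral_excursion hZ hdec hinc v
    (u := fun k => 2 * (g f ((k + 1 : ℕ) * v) * F f ((k + 1 : ℕ) * v)))
    (hs.congr fun k => by ring)
  constructor
  · rw [memLp_two_iff_integrable_sq (measurable_of_countable _).aestronglyMeasurable]
    simp_rw [e]
    exact h1
  · simp_rw [e]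
    rw [h2, ← tsum_mul_left]
    simp_rw [mul_assoc]

/-- The second moment of the sum over a cycle determines the asymptotic variance. -/
lemma memLp_and_integral_cycleSum_sq (hZ : Summable fun x : ℤ => Real.exp (-U x))
    (hdec : AntitoneOn U (Set.Iic 0)) (hinc : MonotoneOn U (Set.Ici 0))
    (hf : Integrable f (phaseMeasure U))
    (hgF : Integrable (fun x => g f x * F f x) (gibbsMeasure U))
    (hf0 : ∫ z, f z ∂(phaseMeasure U) = 0) :
    MemLp (cycleSum f) 2 (cycleMeasure U) ∧
      ∫ c, cycleSum f c ^ 2 ∂(cycleMeasure U) = 2 / gibbs U 0 * asympVar U f := by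
  have := isProbabilityMeasure_excursionMeasure hZ hdec hinc 1
  have := isProbabilityMeasure_excursionMeasure hZ hdec hinc (-1)
  have hπ := gibbs_pos hZ 0
  have hgF' := (integrable_count_withDensity_iff fun x => (gibbs_pos hZ x).le).1 hgF
  obtain ⟨h1, h1'⟩ := memLp_and_integral_excursionSum_sq hZ hdec hinc hgF' 1
  obtain ⟨h2, h2'⟩ := memLp_and_integral_excursionSum_sq hZ hdec hinc hgF' (-1)
  obtain ⟨-, m1⟩ := integrable_and_integral_excursionSum hZ hdec hinc hf 1
  obtain ⟨-, m2⟩ := integrable_and_integral_excursionSum hZ hdec hinc hf (-1)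
  obtain ⟨-, m0⟩ := integrable_and_integral_cycleSum hZ hdec hinc hf
  rw [hf0, mul_zero] at m0
  have h1c : MemLp (fun n => g f 0 + excursionSum f 1 n) 2 (excursionMeasure U 1) := by
    have c0 : MemLp (fun _ : ℕ => g f 0) 2 (excursionMeasure U 1) := memLp_const _
    exact c0.add h1
  have e : cycleSum f = fun c => (g f 0 + excursionSum f 1 c.1) + excursionSum f (-1) c.2 :=
    funext (cycleSum_eq f)
  have hL : MemLp (cycleSum f) 2 (cycleMeasure U) := by
    have a1 : MemLp (fun c : ℕ × ℕ => g f 0 + excursionSum f 1 c.1) 2 (cycleMeasure U) :=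
      h1c.comp_fst _
    have a2 : MemLp (fun c : ℕ × ℕ => excursionSum f (-1) c.2) 2 (cycleMeasure U) :=
      h2.comp_snd _
    rw [e]
    exact a1.add a2
  refine ⟨hL, ?_⟩
  -- The cycle sum is centred, so its second moment is its variance, which is the sum of the
  -- variances of the independent excursions. The constant `g f 0` drops out, matching the removal
  -- of the term `x = 0` of `M`; the squared means of the excursions give the bracket in `asympVar`.
  have hvar := variance_add_prod h1c h2
  rw [← e, ← cycleMeasure, variance_of_integral_eq_zero hL.aemeasurable m0,
    variance_const_add h1.aestronglyMeasurable, variance_eq_sub h1, variance_eq_sub h2] at hvar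
  simp only [Pi.pow_apply] at hvar
  rw [hvar, h1', h2', m1, m2, asympVar, M, integral_gibbsMeasure hZ hgF',
    (setIntegral_gibbsMeasure hZ (summable_g hZ hf)).1,
    (setIntegral_gibbsMeasure hZ (summable_g hZ hf)).2]
  have hF0 : F f 0 = g f 0 / 2 := by simp [F]; ring
  rw [hF0]
  field_simp
  ring

end Integrals

/-! ### The limit theorems for the Zig-Zag walk. -/

section Limits

variable {U : ℤ → ℝ} {f : State → ℝ} {Ω : Type*} [MeasurableSpace Ω] {P : Measure Ω}
  [IsProbabilityMeasure P] {X : ℕ → Ω → State}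

lemma integrable_one_phaseMeasure (hZ : Summable fun x : ℤ => Real.exp (-U x)) :
    Integrable (fun _ : State => (1 : ℝ)) (phaseMeasure U) := by
  have hw := fun z : State => div_nonneg (gibbs_pos hZ z.1).le zero_le_two
  refine (integrable_count_withDensity_iff hw).2 ?_
  have hs : Summable fun z : ℤ × ℤˣ => gibbs U z.1 / 2 := by
    rw [summable_prod_of_nonneg hw]
    refine ⟨fun x => Summable.of_finite, ?_⟩
    refine (hasSum_gibbs hZ).summable.congr fun x => ?_
    rw [tsum_fintype, UnitsInt.univ, Finset.sum_pair (by decide)]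
    ring
  simpa using hs

/-- The mean length of a cycle is `2 / π(0)`. -/
lemma integrable_and_integral_length (hZ : Summable fun x : ℤ => Real.exp (-U x))
    (hdec : AntitoneOn U (Set.Iic 0)) (hinc : MonotoneOn U (Set.Ici 0)) :
    Integrable (fun c => ((cycle c).length : ℝ)) (cycleMeasure U) ∧
      ∫ c, ((cycle c).length : ℝ) ∂(cycleMeasure U) = 2 / gibbs U 0 := by
  have hi := integrable_one_phaseMeasure hZ
  have h := integrable_and_integral_cycleSum hZ hdec hinc hi
  have hone : ∫ _, (1 : ℝ) ∂(phaseMeasure U) = 1 := by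
    rw [integral_phaseMeasure hZ hi]
    have : ∀ x, g (fun _ => 1) x * gibbs U x = 2 * gibbs U x := fun x => by
      rw [g]; ring
    simp_rw [this]
    rw [tsum_mul_left, (hasSum_gibbs hZ).tsum_eq]
    norm_num
  rw [hone, mul_one] at h
  simp_rw [length_cycle]
  exact h

/-- Nonnegativity makes the partial sums monotone, as the interpolation between renewals requires;
the factor `2 / π(0)` cancels between mean reward and mean length. -/
lemma ae_tendsto_average_of_nonneg (hZ : Summable fun x : ℤ => Real.exp (-U x))
    (hdec : AntitoneOn U (Set.Iic 0)) (hinc : MonotoneOn U (Set.Ici 0))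
    (hX : IsMarkovChain P (kernel U) X) (hf : Integrable f (phaseMeasure U)) (hf0 : ∀ z, 0 ≤ f z) :
    ∀ᵐ ω ∂P, Tendsto (fun n : ℕ => (∑ k ∈ Finset.range n, f (X k ω)) / n) atTop
      (𝓝 (∫ z, f z ∂(phaseMeasure U))) := by
  have := isProbabilityMeasure_excursionMeasure hZ hdec hinc 1
  have := isProbabilityMeasure_excursionMeasure hZ hdec hinc (-1)
  have : IsProbabilityMeasure (cycleMeasure U) := by rw [cycleMeasure]; infer_instance
  have hπ := gibbs_pos hZ 0
  obtain ⟨hl, hl'⟩ := integrable_and_integral_length hZ hdec hinc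
  obtain ⟨hR, hR'⟩ := integrable_and_integral_cycleSum hZ hdec hinc hf
  have h := (renewal hZ hdec hinc hX).ae_tendsto_div hl hR
    (s := fun ω n => ∑ k ∈ Finset.range n, f (X k ω)) ?_
  · rw [hR', hl', mul_div_cancel_left₀ _ (by positivity)] at h
    exact h
  · filter_upwards [ae_exists_cycle hZ hdec hinc hX] with ω hω
    refine ⟨monotone_nat_of_le_succ fun n => ?_, by simp,
      IsRegenerative.sum_visitTime_succ (x := (X · ω)) hω f⟩
    rw [Finset.sum_range_succ]
    exact le_add_of_nonneg_right (hf0 _)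

/-- The law of large numbers for the Zig-Zag walk. -/
lemma ae_tendsto_average (hZ : Summable fun x : ℤ => Real.exp (-U x))
    (hdec : AntitoneOn U (Set.Iic 0)) (hinc : MonotoneOn U (Set.Ici 0))
    (hX : IsMarkovChain P (kernel U) X) (hf : Integrable f (phaseMeasure U)) :
    ∀ᵐ ω ∂P, Tendsto (fun n : ℕ => (1 / (n : ℝ)) * ∑ k ∈ Finset.range n, f (X k ω)) atTop
      (𝓝 (∫ z, f z ∂(phaseMeasure U))) := by
  filter_upwards
    [ae_tendsto_average_of_nonneg hZ hdec hinc hX hf.pos_part fun z => le_max_right _ _,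
    ae_tendsto_average_of_nonneg hZ hdec hinc hX hf.neg_part fun z => le_max_right _ _]
    with ω h1 h2
  have h := h1.sub h2
  rw [← integral_sub hf.pos_part hf.neg_part] at h
  have e : ∀ a : ℝ, max a 0 - max (-a) 0 = a := fun a => by
    rcases le_total a 0 with ha | ha
    · rw [max_eq_right ha, max_eq_left (neg_nonneg.2 ha)]; ring
    · rw [max_eq_left ha, max_eq_right (neg_nonpos.2 ha)]; ring
  simp_rw [← sub_div, ← Finset.sum_sub_distrib, e] at h
  refine h.congr fun n => ?_
  rw [one_div_mul_eq_div]

/-- Identifies the variance delivered by the renewal theorem with the closed form: the factor `2 /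
π(0)` is common to the second moment and the mean length. -/
lemma asympVar_eq (hZ : Summable fun x : ℤ => Real.exp (-U x))
    (hdec : AntitoneOn U (Set.Iic 0)) (hinc : MonotoneOn U (Set.Ici 0))
    (hf : Integrable f (phaseMeasure U))
    (hgF : Integrable (fun x => g f x * F f x) (gibbsMeasure U))
    (hf0 : ∫ z, f z ∂(phaseMeasure U) = 0) :
    (∫ c, cycleSum f c ^ 2 ∂(cycleMeasure U)) / ∫ c, ((cycle c).length : ℝ) ∂(cycleMeasure U) =
      asympVar U f := by
  have hπ := gibbs_pos hZ 0
  rw [(memLp_and_integral_cycleSum_sq hZ hdec hinc hf hgF hf0).2,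
    (integrable_and_integral_length hZ hdec hinc).2, mul_div_cancel_left₀ _ (by positivity)]

lemma asympVar_nonneg (hZ : Summable fun x : ℤ => Real.exp (-U x))
    (hdec : AntitoneOn U (Set.Iic 0)) (hinc : MonotoneOn U (Set.Ici 0))
    (hf : Integrable f (phaseMeasure U))
    (hgF : Integrable (fun x => g f x * F f x) (gibbsMeasure U))
    (hf0 : ∫ z, f z ∂(phaseMeasure U) = 0) : 0 ≤ asympVar U f := by
  rw [← asympVar_eq hZ hdec hinc hf hgF hf0]
  exact div_nonneg (integral_nonneg fun c => sq_nonneg _)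
    (integral_nonneg fun c => Nat.cast_nonneg _)

/-- The terms subtracted from `M` in the closed form are nonnegative. -/
lemma asympVar_le (hZ : Summable fun x : ℤ => Real.exp (-U x)) : asympVar U f ≤ M U f := by
  have hπ := gibbs_pos hZ 0
  have h1 : 0 ≤ gibbs U 0 * g f 0 ^ 2 / 2 := by positivity
  have h2 : 0 ≤ ((∫ x in Set.Ici (1 : ℤ), g f x ∂(gibbsMeasure U)) ^ 2 +
      (∫ x in Set.Iic (-1 : ℤ), g f x ∂(gibbsMeasure U)) ^ 2) / (2 * gibbs U 0) := by positivity
  rw [asympVar]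
  linarith

/-- The central limit theorem for the Zig-Zag walk. -/
lemma tendstoInDistribution_average (hZ : Summable fun x : ℤ => Real.exp (-U x))
    (hdec : AntitoneOn U (Set.Iic 0)) (hinc : MonotoneOn U (Set.Ici 0))
    (hX : IsMarkovChain P (kernel U) X) (hf : Integrable f (phaseMeasure U))
    (hgF : Integrable (fun x => g f x * F f x) (gibbsMeasure U))
    (hf0 : ∫ z, f z ∂(phaseMeasure U) = 0) :
    TendstoInDistribution
      (fun (n : ℕ) ω => (1 / Real.sqrt n) * ∑ k ∈ Finset.range n, f (X k ω)) atTop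
      (id : ℝ → ℝ) (fun _ => P) (gaussianReal 0 (asympVar U f).toNNReal) := by
  have := isProbabilityMeasure_excursionMeasure hZ hdec hinc 1
  have := isProbabilityMeasure_excursionMeasure hZ hdec hinc (-1)
  have : IsProbabilityMeasure (cycleMeasure U) := by rw [cycleMeasure]; infer_instance
  have hreg := ae_exists_cycle hZ hdec hinc hX
  have hmean := (integrable_and_integral_cycleSum hZ hdec hinc hf).2
  rw [hf0, mul_zero] at hmean
  rw [← asympVar_eq hZ hdec hinc hf hgF hf0]
  refine (renewal hZ hdec hinc hX).tendstoInDistribution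
    (integrable_and_integral_length hZ hdec hinc).1
    (memLp_and_integral_cycleSum_sq hZ hdec hinc hf hgF hf0).1 hmean
    (s := fun n ω => ∑ k ∈ Finset.range n, f (X k ω))
    (fun n => Finset.measurable_fun_sum _ fun k _ =>
      (measurable_of_countable f).comp (hX.measurable k)) ?_ (cycleSum fun z => |f z|) ?_
  · filter_upwards [hreg] with ω hω
    exact IsRegenerative.sum_visitTime_succ (x := (X · ω)) hω f
  · filter_upwards [hreg] with ω hω j n
    exact IsRegenerative.abs_sum_sub_le (x := (X · ω)) hω f

end Limits

end ZigZag

theorem mainTheorem4 (U : ℤ → ℝ)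
    (hZ : Summable fun x : ℤ => Real.exp (-U x))
    (hdec : AntitoneOn U (Set.Iic 0)) (hinc : MonotoneOn U (Set.Ici 0))
    (f : ZigZag.State → ℝ) (hf : Integrable f (ZigZag.phaseMeasure U))
    {Ω : Type*} [MeasurableSpace Ω] (P : Measure Ω) [IsProbabilityMeasure P]
    (X : ℕ → Ω → ZigZag.State) (hX : ZigZag.IsMarkovChain P (ZigZag.kernel U) X) :
    (∀ᵐ ω ∂P, Tendsto (fun n : ℕ => (1 / (n : ℝ)) * ∑ k ∈ Finset.range n, f (X k ω)) atTop
      (𝓝 (∫ z, f z ∂(ZigZag.phaseMeasure U)))) ∧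
    (Integrable (fun x => ZigZag.g f x * ZigZag.F f x) (ZigZag.gibbsMeasure U) →
      ∫ z, f z ∂(ZigZag.phaseMeasure U) = 0 →
      0 ≤ ZigZag.asympVar U f ∧ ZigZag.asympVar U f ≤ 3 * ZigZag.M U f ∧
      TendstoInDistribution
        (fun (n : ℕ) ω => (1 / Real.sqrt n) * ∑ k ∈ Finset.range n, f (X k ω)) atTop
        (id : ℝ → ℝ) (fun _ => P) (gaussianReal 0 (ZigZag.asympVar U f).toNNReal)) := by
  refine ⟨ZigZag.ae_tendsto_average hZ hdec hinc hX hf, fun hgF hf0 => ?_⟩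
  have h0 := ZigZag.asympVar_nonneg hZ hdec hinc hf hgF hf0
  have h1 := ZigZag.asympVar_le (f := f) hZ
  -- From `0 ≤ σ² ≤ M` it follows that `M ≥ 0`, so the bound by `3 M` is weaker than the bound by
  -- `M`.
  exact ⟨h0, by linarith, ZigZag.tendstoInDistribution_average hZ hdec hinc hX hf hgF hf0⟩
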